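/- Let $p$ be a prime and $n\ge 1$. Let $\mathcal A=\bigoplus_{\mathbb Z}(\mathbb Z/p\mathbb Z)^n$, let $x$ act on $\mathcal A$ by the shift $(x\omega)_i=\omega_{i+1}$, and let $\mathcal L=\mathcal L_{n,p}=(\mathbb Z/p\mathbb Z)^n\wr\mathbb Z=\mathcal A\rtimes\mathbb Z$ be the lamplighter group, with product $(v,s)(w,t)=(v+x^sw,\,s+t)$. For a countable discrete group $G$ let $\mathrm{Sub}(G)$ be the set of subgroups of $G$ with the topology induced from the product topology on $\{0,1\}^G$. Put $\mathcal Z=\mathrm{Sub}(\mathcal L)\setminus\mathrm{Sub}(\mathcal A)$ with the subspace topology. For $V\in\mathcal Z$ let $s>0$ be such that $s\mathbb Z$ is the image of $V$ in $\mathbb Z$, let $U=V\cap\mathcal A$, and let $e$ be the least positive integer with $x^eU=U$ (it exists and divides $s$). Let $\mathrm{rk}_e(U)$ be the rank of $U$ as a module over $\mathbb F_p[x,x^{-1}]$ with the action $x*u=x^eu$. Put $t_V=s/e$, $r_V=ne-\mathrm{rk}_e(U)$ and $\Phi(V)=(t_V,r_V)$. Let $\mathcal Q=\mathbb N\times(\mathbb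 N\cup\{0\})$, where $\mathbb N=\{1,2,\dots\}$, with $(t',r')<(t,r)$ if and only if $t'\mid t$ and $t'r'<tr$; so $\Phi:\mathcal Z\to\mathcal Q$. For a topological space $X$ let $X^0=X$, let $X^{\alpha+1}$ be the set of limit points of $X^\alpha$ in $X^\alpha$, and $X^\lambda=\bigcap_{\alpha<\lambda}X^\alpha$ for limit ordinals $\lambda$; the Cantor–Bendixson rank of $X$ is the least $\alpha$ with $X^\beta=X^\alpha$ for all $\beta\ge\alpha$. For a set $P$ with a transitive relation $<$ let $P_0$ be the set of minimal elements of $P$, let $P_{\alpha+1}$ be the union of $P_\alpha$ and the set of minimal elements of $P\setminus P_\alpha$, and $P_\lambda=\bigcup_{\alpha<\lambda}P_\alpha$ for limit ordinals $\lambda$; the Cantor–Bendixson rank of $P$ is the least $\alpha$ with $P\setminus P_\alpha=P\setminus P_{\alpha+1}$. Then: 1. $\Phi$ is order-preserving with respect to convergence in $\mathcal Z$: every $V\in\mathcal Z$ has a neighbourhood in $\mathcal Z$ such that each $W$ in it contains $V$ and satisfies $\Phi(W)<\Phi(V)$ whenever $W\ne V$. 2. For every $V\in\mathcal Z$ and every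 $q\in\mathcal Q$ with $q<\Phi(V)$ there is a sequence $(V_m)$ in $\mathcal Z$ with $\Phi(V_m)=q$ for all $m$ and $V_m\to V$. 3. If $(V_m)$ is a sequence in $\mathcal Z$ that converges to $V\in\mathcal Z$ and $V_m\ne V$ for every $m$, then there are a subsequence $(V_{m_k})$ and some $q<\Phi(V)$ such that $\Phi(V_{m_k})=q$ for all $k$. 4. The Cantor–Bendixson rank of $\mathrm{Sub}(\mathcal L_{n,p})$ is equal to the Cantor–Bendixson rank of $\mathcal Q$. -/

import Mathlib

open Set Filter Topology

noncomputable section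

/-! ### The space of subgroups of a group -/

open scoped Classical in
/-- The characteristic function `G → {0,1}` of a subgroup. -/
def subgroupChar {G : Type*} [Group G] (H : Subgroup G) : G → Bool :=
  fun g => decide (g ∈ H)

/-- `Sub(G)` (for a discrete group `G`): the set of all subgroups with the topology induced by the
Tychonoff topology of `{0,1}^G`. -/
instance subgroupTopology {G : Type*} [Group G] : TopologicalSpace (Subgroup G) :=
  TopologicalSpace.induced subgroupChar Pi.topologicalSpace

/-! ### Cantor-Bendixson ranks -/

/-- The Cantor-Bendixson rank of a topological space: the least ordinal `a` from which on the
iterated derivatives `X^a` are constant. -/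
def cbRank (X : Type*) [TopologicalSpace X] : Ordinal :=
  sInf {a | ∀ b, a ≤ b → CantorBendixson.iteratedDerivedSet (univ : Set X) b =
    CantorBendixson.iteratedDerivedSet (univ : Set X) a}

/-- The minimal elements of a subset `S` of a set with a relation `<`. -/
def minimalElts {P : Type*} [LT P] (S : Set P) : Set P :=
  {x | x ∈ S ∧ ∀ y ∈ S, ¬ y < x}

/-- The sets `P_a`: `P_0` consists of the minimal elements of `P`, `P_{a+1}` is the union of `P_a`
and the minimal elements of its complement, and unions are taken at limit ordinals. -/
def posetLevel (P : Type*) [LT P] (a : Ordinal) : Set P :=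
  Ordinal.limitRecOn (motive := fun _ => Set P) a (minimalElts univ)
    (fun _ S => S ∪ minimalElts Sᶜ)
    (fun b _ S => ⋃ (c : Ordinal) (hc : c < b), S c hc)

/-- The Cantor-Bendixson rank of a set with a relation `<`: the least ordinal `a` such that the
complements of `P_a` and of `P_{a+1}` coincide. -/
def posetRank.{u} (P : Type u) [LT P] : Ordinal.{u} :=
  sInf {a | (posetLevel P a)ᶜ = (posetLevel P (a + 1))ᶜ}

/-! ### The poset `Q` -/

/-- The set `ℕ × (ℕ ∪ {0})`. -/
@[ext] structure QPoset where
  t : ℕ+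
  r : ℕ

/-- `(t',r') < (t,r)` if and only if `t' ∣ t` and `t' r' < t r`. -/
instance : PartialOrder QPoset where
  lt a b := (a.t : ℕ) ∣ (b.t : ℕ) ∧ (a.t : ℕ) * a.r < (b.t : ℕ) * b.r
  le a b := a = b ∨ ((a.t : ℕ) ∣ (b.t : ℕ) ∧ (a.t : ℕ) * a.r < (b.t : ℕ) * b.r)
  le_refl a := Or.inl rfl
  le_trans a b c := by
    rintro (rfl | h) (rfl | h')
    · exact Or.inl rfl
    · exact Or.inr h'
    · exact Or.inr h
    · exact Or.inr ⟨h.1.trans h'.1, h.2.trans h'.2⟩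
  le_antisymm a b := by
    rintro (rfl | h) (h' | h')
    · rfl
    · rfl
    · exact h'.symm
    · exact absurd (h.2.trans h'.2) (lt_irrefl _)
  lt_iff_le_not_ge a b := by
    constructor
    · intro h
      refine ⟨Or.inr h, ?_⟩
      rintro (rfl | h')
      · exact lt_irrefl _ h.2
      · exact lt_irrefl _ (h.2.trans h'.2)
    · rintro ⟨rfl | h, h'⟩
      · exact absurd (Or.inl rfl) h'
      · exact h

/-! ### Lamplighter groups -/

/-- The group `A = ⊕_ℤ (ℤ/pℤ)^n`. -/
abbrev LampBase (n p : ℕ) : Type := ℤ →₀ (Fin n → ZMod p)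

/-- The action of `x^a` on `A`, `(x^a ω)_i = ω_{i+a}`. -/
def shift (n p : ℕ) (a : ℤ) : LampBase n p ≃+ LampBase n p :=
  Finsupp.domCongr (Equiv.addRight a).symm

@[simp] lemma shift_apply (n p : ℕ) (a : ℤ) (w : LampBase n p) (i : ℤ) :
    shift n p a w i = w (i + a) := rfl

/-- The action of `ℤ` on `A` by shifts, written multiplicatively. -/
def shiftAut (n p : ℕ) : Multiplicative ℤ →* MulAut (Multiplicative (LampBase n p)) where
  toFun a := AddEquiv.toMultiplicative (shift n p a.toAdd)
  map_one' := by
    ext w : 1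
    change Multiplicative.ofAdd (shift n p 0 w.toAdd) = w
    apply Multiplicative.toAdd.injective
    refine Finsupp.ext fun i => ?_
    rw [toAdd_ofAdd, shift_apply, add_zero]
  map_mul' a b := by
    ext w : 1
    change Multiplicative.ofAdd (shift n p (a.toAdd + b.toAdd) w.toAdd) =
      Multiplicative.ofAdd (shift n p a.toAdd (shift n p b.toAdd w.toAdd))
    congr 1
    refine Finsupp.ext fun i => ?_
    simp only [shift_apply, add_assoc]

/-- The lamplighter group `L = (ℤ/pℤ)^n ≀ ℤ = A ⋊ ℤ`, with `(v,s)(w,t) = (v + x^s w, s + t)`. -/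
abbrev Lamplighter (n p : ℕ) : Type :=
  SemidirectProduct (Multiplicative (LampBase n p)) (Multiplicative ℤ) (shiftAut n p)

/-- The element `(v,s)` of the lamplighter group. -/
def lampMk {n p : ℕ} (v : LampBase n p) (s : ℤ) : Lamplighter n p :=
  ⟨Multiplicative.ofAdd v, Multiplicative.ofAdd s⟩

/-- `A` as a subgroup of the lamplighter group. -/
def baseSubgroup (n p : ℕ) : Subgroup (Lamplighter n p) :=
  (SemidirectProduct.inl : Multiplicative (LampBase n p) →* Lamplighter n p).range

/-- `Z = Sub(L) \ Sub(A)`. -/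
def ZSet (n p : ℕ) : Set (Subgroup (Lamplighter n p)) :=
  {V | ¬ V ≤ baseSubgroup n p}

/-- `V ∩ A`, as a subgroup of `A`. -/
def basePart {n p : ℕ} (V : Subgroup (Lamplighter n p)) : AddSubgroup (LampBase n p) where
  carrier := {w | lampMk w 0 ∈ V}
  zero_mem' := V.one_mem
  add_mem' {a b} ha hb := by
    have h := V.mul_mem ha hb
    have e : lampMk a 0 * lampMk b 0 = lampMk (n := n) (p := p) (a + b) 0 := by
      refine SemidirectProduct.ext ?_ rfl
      change Multiplicative.ofAdd a * shiftAut n p 1 (Multiplicative.ofAdd b) = _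
      rw [map_one]; rfl
    rwa [e] at h
  neg_mem' {a} ha := by
    have h := V.inv_mem ha
    have e : (lampMk a 0)⁻¹ = lampMk (n := n) (p := p) (-a) 0 := by
      refine SemidirectProduct.ext ?_ rfl
      change shiftAut n p 1⁻¹ (Multiplicative.ofAdd a)⁻¹ = _
      rw [inv_one, map_one]; rfl
    rwa [e] at h

/-- The image of a subgroup `V` under the projection to `ℤ` has the form `sℤ`. -/
lemma exists_projGen {n p : ℕ} (V : Subgroup (Lamplighter n p)) :
    ∃ s : ℕ, ∀ k : ℤ, (∃ v, lampMk v k ∈ V) ↔ (s : ℤ) ∣ k := by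
  let K : AddSubgroup ℤ := (V.map SemidirectProduct.rightHom).toAddSubgroup'
  obtain ⟨a, ha⟩ := Int.subgroup_cyclic K
  refine ⟨a.natAbs, fun k => ?_⟩
  have hk : k ∈ K ↔ ∃ v, lampMk v k ∈ V := by
    constructor
    · rintro ⟨g, hg, hgk⟩
      refine ⟨g.left.toAdd, ?_⟩
      have : lampMk g.left.toAdd k = g := SemidirectProduct.ext rfl hgk.symm
      rwa [this]
    · rintro ⟨v, hv⟩
      exact ⟨_, hv, rfl⟩
  rw [← hk, ha, ← AddSubgroup.zmultiples_eq_closure, Int.mem_zmultiples_iff, Int.natAbs_dvd]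

/-- The number `s ≥ 0` such that `sℤ` is the image of the projection of `V` to `ℤ`. -/
def projGen {n p : ℕ} (V : Subgroup (Lamplighter n p)) : ℕ :=
  (exists_projGen V).choose

lemma projGen_spec {n p : ℕ} (V : Subgroup (Lamplighter n p)) (k : ℤ) :
    (∃ v, lampMk v k ∈ V) ↔ (projGen V : ℤ) ∣ k :=
  (exists_projGen V).choose_spec k

/-! ### Periods and ranks of subgroups of `A` -/

/-- `x^m U = U`. -/
def IsPeriod {n p : ℕ} (U : AddSubgroup (LampBase n p)) (m : ℕ) : Prop :=
  U.map (shift n p m).toAddMonoidHom = U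

lemma IsPeriod.shift_mem {n p : ℕ} {U : AddSubgroup (LampBase n p)} {m : ℕ} (h : IsPeriod U m)
    (a : ℤ) {w : LampBase n p} (hw : w ∈ U) : shift n p (m * a) w ∈ U := by
  have key : ∀ v, shift n p m v ∈ U ↔ v ∈ U := fun v => by
    constructor
    · intro hv
      rw [← h] at hv
      obtain ⟨u, hu, huv⟩ := hv
      rwa [← (shift n p m).injective huv]
    · intro hv
      rw [← h]
      exact ⟨v, hv, rfl⟩
  induction a using Int.induction_on with
  | zero =>
    have : shift n p (m * 0) w = w := Finsupp.ext fun i => by simp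
    rwa [this]
  | succ k ih =>
    have : shift n p (m * (k + 1)) w = shift n p m (shift n p (m * k) w) :=
      Finsupp.ext fun i => by simp only [shift_apply]; congr 1; ring
    rw [this]
    exact (key _).2 ih
  | pred k ih =>
    have : shift n p (m * -k) w = shift n p m (shift n p (m * (-k - 1)) w) :=
      Finsupp.ext fun i => by simp only [shift_apply]; congr 1; ring
    rw [this] at ih
    exact (key _).1 ih

/-- `e(U)`, the minimal positive `e` with `x^e U = U`. If there is none, the value `0` stands
for `+∞`. -/
def period {n p : ℕ} (U : AddSubgroup (LampBase n p)) : ℕ :=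
  sInf {e | 0 < e ∧ IsPeriod U e}

/-- A copy of `A`, made into a module over `R = 𝔽_p[x,x⁻¹]` in which `x` acts as `x^m` does on
`A`. -/
def Twist (n p : ℕ) (_m : ℕ) : Type := LampBase n p

instance (n p m : ℕ) : AddCommGroup (Twist n p m) :=
  inferInstanceAs (AddCommGroup (ℤ →₀ (Fin n → ZMod p)))

/-- The identity map from `A` to its copy. -/
def toTwist {n p : ℕ} (m : ℕ) : LampBase n p ≃+ Twist n p m := AddEquiv.refl _

instance twistBaseModule (n p m : ℕ) : Module (ZMod p) (Twist n p m) :=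
  inferInstanceAs (Module (ZMod p) (ℤ →₀ (Fin n → ZMod p)))

/-- The action of the powers of `x` on `Twist n p m`: `x^a` acts as `x^(m a)` does on `A`. -/
def twistRep (n p m : ℕ) : Multiplicative ℤ →* Module.End (ZMod p) (Twist n p m) where
  toFun a :=
    { toFun := shift n p (m * a.toAdd)
      map_add' := (shift n p (m * a.toAdd)).map_add
      map_smul' := fun _ _ => Finsupp.ext fun _ => rfl }
  map_one' := by
    refine LinearMap.ext fun (w : LampBase n p) => Finsupp.ext fun i => ?_
    change shift n p (m * 0) w i = w i
    rw [shift_apply, mul_zero, add_zero]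
  map_mul' a b := by
    refine LinearMap.ext fun (w : LampBase n p) => Finsupp.ext fun i => ?_
    change shift n p (m * (a.toAdd + b.toAdd)) w i =
      shift n p (m * a.toAdd) (shift n p (m * b.toAdd) w) i
    simp only [shift_apply, mul_add, add_assoc]

lemma twistRep_apply (n p m : ℕ) (a : ℤ) (w : LampBase n p) :
    twistRep n p m (Multiplicative.ofAdd a) (toTwist m w) = toTwist m (shift n p (m * a) w) := rfl

/-- The `R`-module structure: `f = ∑ f_a x^a` acts as `∑ f_a x^(m a)`. -/
instance twistModule (n p m : ℕ) : Module (LaurentPolynomial (ZMod p)) (Twist n p m) :=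
  Module.compHom (Twist n p m)
    (AddMonoidAlgebra.lift (ZMod p) (Module.End (ZMod p) (Twist n p m)) ℤ
      (twistRep n p m)).toRingHom

/-- The `R`-submodule of `Twist n p m` generated by a subgroup `U` of `A`. It is `U` itself if
`x^m U = U`; see `coe_twistSpan`. -/
def twistSpan {n p : ℕ} (m : ℕ) (U : AddSubgroup (LampBase n p)) :
    Submodule (LaurentPolynomial (ZMod p)) (Twist n p m) :=
  Submodule.span _ (toTwist m '' (U : Set (LampBase n p)))

lemma coe_twistSpan {n p : ℕ} {m : ℕ} {U : AddSubgroup (LampBase n p)} (h : IsPeriod U m) :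
    (twistSpan m U : Set (Twist n p m)) = toTwist m '' (U : Set (LampBase n p)) := by
  refine subset_antisymm (fun w hw => ?_) Submodule.subset_span
  have hmem : ∀ y : Twist n p m, y ∈ toTwist m '' (U : Set (LampBase n p)) ↔
      y ∈ U.map (toTwist m).toAddMonoidHom := fun y => Iff.rfl
  refine Submodule.span_induction (p := fun y _ => y ∈ toTwist m '' (U : Set (LampBase n p)))
    (fun x hx => hx) ?_ ?_ ?_ hw
  · rw [hmem]; exact zero_mem _
  · intro x y _ _ hx hy
    rw [hmem] at *; exact add_mem hx hy
  · rintro f _ _ ⟨u, hu, rfl⟩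
    change (AddMonoidAlgebra.lift (ZMod p) (Module.End (ZMod p) (Twist n p m)) ℤ
        (twistRep n p m) f) (toTwist m u) ∈ toTwist m '' (U : Set (LampBase n p))
    rw [AddMonoidAlgebra.lift_apply, Finsupp.sum, LinearMap.sum_apply, hmem]
    refine sum_mem fun a _ => ?_
    rw [LinearMap.smul_apply, twistRep_apply]
    obtain ⟨k, hk⟩ := ZMod.intCast_surjective (f.coeff a)
    rw [← hk, Int.cast_smul_eq_zsmul]
    exact AddSubgroup.zsmul_mem _ (AddSubgroup.mem_map_of_mem _ (h.shift_mem a hu)) k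

/-- `rk_m(U)`, for `x^m U = U`: the rank of `U` as an `R`-module via `x * u = x^m u`. -/
def rk {n p : ℕ} (m : ℕ) (U : AddSubgroup (LampBase n p)) : ℕ :=
  Module.finrank (LaurentPolynomial (ZMod p)) (twistSpan m U)

/-! ### The map `Φ` -/

lemma isPeriod_projGen {n p : ℕ} (V : Subgroup (Lamplighter n p)) :
    IsPeriod (basePart V) (projGen V) := by
  obtain ⟨v, hv⟩ := (projGen_spec V (projGen V)).2 dvd_rfl
  have conj1 : ∀ w : LampBase n p,
      lampMk v (projGen V) * lampMk w 0 =
        lampMk (shift n p (projGen V) w) 0 * lampMk v (projGen V) := by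
    intro w
    refine SemidirectProduct.ext ?_ ?_
    · have h1 : shiftAut n p (Multiplicative.ofAdd 0) = 1 := map_one _
      rw [SemidirectProduct.mul_left, SemidirectProduct.mul_left]
      simp only [lampMk, h1, MulAut.one_apply]
      exact mul_comm _ _
    · exact mul_comm _ _
  refine le_antisymm ?_ ?_
  · rintro _ ⟨w, hw, rfl⟩
    have h := V.mul_mem hv hw
    rw [conj1, V.mul_mem_cancel_right hv] at h
    exact h
  · intro w hw
    refine ⟨(shift n p (projGen V)).symm w, ?_, (shift n p (projGen V)).apply_symm_apply w⟩
    have h := V.mul_mem (show lampMk w 0 ∈ V from hw) hv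
    have h2 := conj1 ((shift n p (projGen V)).symm w)
    rw [AddEquiv.apply_symm_apply] at h2
    rw [← h2, V.mul_mem_cancel_left hv] at h
    exact h

lemma projGen_pos {n p : ℕ} {V : Subgroup (Lamplighter n p)} (hV : V ∈ ZSet n p) :
    0 < projGen V := by
  rw [Nat.pos_iff_ne_zero]
  intro h0
  refine hV fun g hg => ?_
  have hg' : lampMk g.left.toAdd g.right.toAdd = g := SemidirectProduct.ext rfl rfl
  have h := (projGen_spec V g.right.toAdd).1 ⟨g.left.toAdd, by rwa [hg']⟩
  rw [h0, Nat.cast_zero, zero_dvd_iff] at h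
  exact ⟨g.left, SemidirectProduct.ext rfl (Multiplicative.toAdd.injective h.symm)⟩

lemma period_pos {n p : ℕ} {V : Subgroup (Lamplighter n p)} (hV : V ∈ ZSet n p) :
    0 < period (basePart V) ∧ period (basePart V) ≤ projGen V := by
  have h : projGen V ∈ {e | 0 < e ∧ IsPeriod (basePart V) e} :=
    ⟨projGen_pos hV, isPeriod_projGen V⟩
  exact ⟨(Nat.sInf_mem ⟨_, h⟩).1, Nat.sInf_le h⟩

/-- `Φ(V) = (t_V, r_V)` with `t_V = s / e` and `r_V = n e - rk_e(U)`, where `sℤ` is the image of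
the projection of `V` to `ℤ`, `U = V ∩ A` and `e = e(U)`. The division is exact and the difference
is nonnegative. -/
def Phi {n p : ℕ} (V : ZSet n p) : QPoset where
  t := ⟨projGen V.1 / period (basePart V.1),
    Nat.div_pos (period_pos V.2).2 (period_pos V.2).1⟩
  r := n * period (basePart V.1) - rk (period (basePart V.1)) (basePart V.1)

end

open Set Filter Topology

noncomputable section

/-! ### Laurent polynomials over a field: finite quotients, and powers of `T 1 - 1`. -/

section Laurent

open scoped LaurentPolynomial

variable {K : Type*} [Field K]

/-! Let `R = 𝔽_p[T,T⁻¹]`. If `x^m U = U`, then `A / U` is a finitely generated `R`-module with `T`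
acting as `x^m`. Replacing `m` by `m k` restricts scalars along `T ↦ T^k` and multiplies ranks by
`k`. As `s = e t`, the number `t_V r_V` is therefore the rank of `A / U` for the action of `x^s`
(`Phi_t_mul_r`). This identity governs everything.

Neighbourhoods (`eventually_le_and_Phi_lt`). `R` is Noetherian, so `V` is generated by one element
over `s` and finitely many translates-generators of `U`; hence every `W` near `V` contains `V`. Then
`s_W ∣ s_V`, and `e_V ∣ e_W` because failure of a period is witnessed by a single element; so `t_W ∣
t_V`. The coranks satisfy `t_W r_W ≤ t_V r_V`. Equality makes `U_W / U_V` torsion, but the torsion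
of `A / U_V` is finite since `𝔽_p` is, so a small neighbourhood forces `U_W = U_V`. The same
finiteness then forces `s_W = s_V`, and `W = V`.

Approximation (`exists_tendsto_of_lt_Phi`). To realise `(t',r') < (t,r)`, put `m = e t / t'` and
keep `s`. Enlarge `U` by multiples `h^i b_0`, `h^(2i) b_k` of vectors independent modulo torsion,
with `h = T - 1`. High divisibility by `h` gives convergence to `U`; the different exponents destroy
every proper divisor of `m` as a period, because `T` is not a proper power in `R`.

Subsequences come from pigeonhole, since only finitely many `q` lie below `Φ(V)`. For the ranks,
`(1,k)` lies below every `(t,r)` with `t r > k`, so both filtrations are governed by `t r`: the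
`k`-th derivative of `Sub(L)` is `Sub(A)` together with `{t r ≥ k}`, and `Sub(A)` has no isolated
points. Both ranks are `ω`. -/

instance LaurentPolynomial.isPrincipalIdealRing : IsPrincipalIdealRing K[T;T⁻¹] where
  principal J := by
    obtain ⟨g, hg⟩ := IsPrincipalIdealRing.principal
      (J.comap (algebraMap (Polynomial K) K[T;T⁻¹]))
    refine ⟨algebraMap (Polynomial K) K[T;T⁻¹] g, ?_⟩
    refine (IsLocalization.map_under (Submonoid.powers (Polynomial.X : Polynomial K))
      K[T;T⁻¹] J).symm.trans ?_
    refine (congrArg (Ideal.map _) hg).trans ?_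
    exact (Ideal.map_span _ _).trans (by rw [Set.image_singleton])

/-- `J` contains a nonzero polynomial `g`, so the image of `K[X]` in the quotient is finite, being
an image of `K[X]/(g)`. By pigeonhole `T` has finite multiplicative order there, so its inverse is
already in that image. -/
lemma LaurentPolynomial.finite_quotient [Finite K] {J : Ideal K[T;T⁻¹]} (hJ : J ≠ ⊥) :
    Finite (K[T;T⁻¹] ⧸ J) := by
  obtain ⟨f, hfJ, hf⟩ := Submodule.exists_mem_ne_zero_of_ne_bot hJ
  obtain ⟨N, g, hg⟩ := f.exists_T_pow
  have hg0 : g ≠ 0 := by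
    rintro rfl
    rw [map_zero, eq_comm, (LaurentPolynomial.isUnit_T (N : ℤ)).mul_left_eq_zero] at hg
    exact hf hg
  let q : Polynomial K →+* K[T;T⁻¹] ⧸ J :=
    (Ideal.Quotient.mk J).comp (Polynomial.toLaurent (R := K))
  have hq : ∀ a ∈ Ideal.span {g}, q a = 0 := by
    intro a ha
    obtain ⟨b, rfl⟩ := Ideal.mem_span_singleton.1 ha
    have : q g = 0 := by
      change Ideal.Quotient.mk J (Polynomial.toLaurent g) = 0
      rw [hg]
      exact Ideal.Quotient.eq_zero_iff_mem.2 (J.mul_mem_right _ hfJ)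
    rw [map_mul, this, zero_mul]
  have : Finite (AdjoinRoot g) := by
    have := (AdjoinRoot.powerBasis hg0).finite
    exact Module.finite_of_finite K
  have hfin : (Set.range q).Finite := by
    have h : Set.range q ⊆ Set.range (Ideal.Quotient.lift (Ideal.span {g}) q hq) := by
      rintro _ ⟨a, rfl⟩
      exact ⟨Ideal.Quotient.mk _ a, Ideal.Quotient.lift_mk _ _ _⟩
    exact (Set.finite_range (ι := AdjoinRoot g) _).subset h
  have hXn : ∀ m : ℕ, q (Polynomial.X ^ m) = Ideal.Quotient.mk J (LaurentPolynomial.T m) :=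
    fun m => congrArg _ (Polynomial.toLaurent_X_pow m)
  obtain ⟨a, -, b, -, hab, h⟩ := Set.infinite_univ.exists_lt_map_eq_of_mapsTo
    (f := fun m : ℕ => q (Polynomial.X ^ m)) (t := Set.range q) (fun m _ => ⟨_, rfl⟩) hfin
  -- From `T^(b-a) = 1` in the quotient, `T⁻¹ = T^(b-a-1)`.
  have hinv : ∀ m : ℕ, Ideal.Quotient.mk J (LaurentPolynomial.T (-(m : ℤ))) =
      q (Polynomial.X ^ ((b - a - 1) * m)) := by
    have h1 : Ideal.Quotient.mk J (LaurentPolynomial.T (((b - a : ℕ) : ℤ))) = 1 := by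
      have h2 := congrArg (· * Ideal.Quotient.mk J (LaurentPolynomial.T (-(a : ℤ)))) h
      simp only [hXn, ← map_mul, ← LaurentPolynomial.T_add] at h2
      rw [add_neg_cancel, LaurentPolynomial.T_zero, map_one] at h2
      rw [h2, Nat.cast_sub hab.le, sub_eq_add_neg]
    intro m
    have h3 := congrArg (· ^ m) h1
    simp only [one_pow, ← map_pow, LaurentPolynomial.T_pow] at h3
    rw [hXn, ← one_mul (Ideal.Quotient.mk J (LaurentPolynomial.T (-(m : ℤ)))), ← h3, ← map_mul,
      ← LaurentPolynomial.T_add]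
    congr 2
    obtain ⟨c, rfl⟩ := Nat.exists_eq_add_of_lt hab
    have e1 : a + c + 1 - a = c + 1 := by omega
    rw [e1]
    push_cast [Nat.add_sub_cancel]
    ring
  have hsurj : Function.Surjective q := by
    intro y
    obtain ⟨y, rfl⟩ := Ideal.Quotient.mk_surjective y
    obtain ⟨M, y', hy'⟩ := y.exists_T_pow
    refine ⟨y' * Polynomial.X ^ ((b - a - 1) * M), ?_⟩
    rw [map_mul, ← hinv]
    change Ideal.Quotient.mk J (Polynomial.toLaurent y') * _ = _
    rw [hy', ← map_mul, mul_assoc, ← LaurentPolynomial.T_add, add_neg_cancel,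
      LaurentPolynomial.T_zero, mul_one]
  rw [← Set.finite_univ_iff, ← hsurj.range_eq]
  exact hfin

lemma LaurentPolynomial.finite_of_isTorsion [Finite K] (M : Type*) [AddCommGroup M]
    [Module K[T;T⁻¹] M] [Module.Finite K[T;T⁻¹] M]
    (hM : ∀ x : M, ∃ a : K[T;T⁻¹], a ≠ 0 ∧ a • x = 0) : Finite M := by
  suffices h : ∀ N : Submodule K[T;T⁻¹] M, N.FG → (N : Set M).Finite by
    rw [← Set.finite_univ_iff]
    exact h ⊤ Module.Finite.fg_top
  refine fun N hN => Submodule.fg_induction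
    (motive := fun N _ => (N : Set M).Finite) ?_ ?_ N hN
  · intro x
    obtain ⟨a, ha, hax⟩ := hM x
    have : Finite (K[T;T⁻¹] ⧸ Ideal.span {a}) :=
      LaurentPolynomial.finite_quotient (by simpa using ha)
    let l : K[T;T⁻¹] ⧸ Ideal.span {a} →ₗ[K[T;T⁻¹]] M :=
      Submodule.liftQ _ (LinearMap.toSpanSingleton _ _ x) (by
        rw [Ideal.span_le]; simpa using hax)
    refine (Set.finite_range l).subset ?_
    intro y hy
    obtain ⟨c, rfl⟩ := Submodule.mem_span_singleton.1 hy
    exact ⟨Submodule.Quotient.mk c, rfl⟩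
  · intro N₁ N₂ _ _ h₁ h₂
    rw [Submodule.coe_sup]
    exact h₁.add h₂

lemma LaurentPolynomial.not_isUnit_T_sub_one :
    ¬ IsUnit (LaurentPolynomial.T 1 - 1 : K[T;T⁻¹]) := by
  intro h
  have h1 := h.map (LaurentPolynomial.eval₂ (RingHom.id K) 1)
  rw [map_sub, map_one, LaurentPolynomial.eval₂_T] at h1
  simp at h1

lemma LaurentPolynomial.T_sub_one_ne_zero : (LaurentPolynomial.T 1 - 1 : K[T;T⁻¹]) ≠ 0 := by
  intro h
  have := congrArg LaurentPolynomial.degree (sub_eq_zero.1 h)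
  rw [← LaurentPolynomial.T_zero, LaurentPolynomial.degree_T, LaurentPolynomial.degree_T] at this
  exact absurd this (by decide)

/-- A nonzero element has finite multiplicity at a nonunit of a Noetherian domain. All convergence
of the approximating subgroups of `A` rests on this. -/
lemma LaurentPolynomial.eventually_not_pow_dvd {c : K[T;T⁻¹]} (hc : c ≠ 0) :
    ∀ᶠ m : ℕ in atTop, ¬ (LaurentPolynomial.T 1 - 1 : K[T;T⁻¹]) ^ m ∣ c := by
  obtain ⟨N, hN⟩ := FiniteMultiplicity.of_not_isUnit
    (LaurentPolynomial.not_isUnit_T_sub_one (K := K)) hc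
  filter_upwards [eventually_ge_atTop (N + 1)] with m hm h
  exact hN ((pow_dvd_pow _ hm).trans h)

/-- After clearing denominators, comparison of degrees gives `l ∣ l N + 1`. This keeps `x^d`, for a
proper divisor `d` of `m`, from acting on a line by a scalar. -/
lemma LaurentPolynomial.eq_one_of_pow_eq_T {c : K[T;T⁻¹]} {l : ℕ}
    (h : c ^ l = LaurentPolynomial.T 1) : l = 1 := by
  obtain ⟨N, g, hg⟩ := c.exists_T_pow
  have h1 : g ^ l = Polynomial.X ^ (l * N + 1) := by
    apply Polynomial.toLaurent_injective
    rw [map_pow, hg, mul_pow, h, LaurentPolynomial.T_pow, Polynomial.toLaurent_X_pow,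
      ← LaurentPolynomial.T_add]
    congr 1
    push_cast
    ring
  have h2 := congrArg Polynomial.natDegree h1
  rw [Polynomial.natDegree_pow, Polynomial.natDegree_X_pow] at h2
  have h3 : l ∣ 1 := (Nat.dvd_add_right (dvd_mul_right l N)).1 (h2 ▸ dvd_mul_right l _)
  exact Nat.dvd_one.1 h3

end Laurent

/-! ### Ranks and coranks over the powers of the shift. -/

section TwistModule

open scoped LaurentPolynomial
open LaurentPolynomial (T)

variable {n p : ℕ}

/-- Constants in `ZMod p` are images of integers, so additivity takes care of them and only the
powers of `T` need checking. -/
lemma LaurentPolynomial.map_smul_of_map_T_smul {S M M' : Type*} [Ring S] [AddCommGroup M]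
    [AddCommGroup M'] [Module (ZMod p)[T;T⁻¹] M] [Module S M'] (φ : (ZMod p)[T;T⁻¹] →+* S)
    (g : M →+ M') (h : ∀ (b : ℤ) (x : M), g ((T b : (ZMod p)[T;T⁻¹]) • x) = φ (T b) • g x)
    (f : (ZMod p)[T;T⁻¹]) (x : M) : g (f • x) = φ f • g x := by
  induction f using LaurentPolynomial.induction_on' with
  | add f₁ f₂ h₁ h₂ => rw [add_smul, map_add, h₁, h₂, map_add, add_smul]
  | C_mul_T b a =>
    obtain ⟨k, rfl⟩ := ZMod.intCast_surjective a
    rw [map_intCast, map_mul, map_intCast, mul_smul, mul_smul, Int.cast_smul_eq_zsmul,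
      Int.cast_smul_eq_zsmul, map_zsmul, h]

lemma T_smul_toTwist (m : ℕ) (b : ℤ) (w : LampBase n p) :
    (T b : (ZMod p)[T;T⁻¹]) • toTwist m w = toTwist m (shift n p (m * b) w) := by
  change (AddMonoidAlgebra.lift (ZMod p) (Module.End (ZMod p) (Twist n p m)) ℤ
        (twistRep n p m) (AddMonoidAlgebra.single b 1)) (toTwist m w) = _
  rw [AddMonoidAlgebra.lift_single, one_smul, twistRep_apply]

/-- The coordinates of a configuration `w` in the basis of `Twist n p m` formed by the `m n`
configurations with a single entry `1` in one of the places `0, …, m - 1`. -/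
def twistCoord (n p m : ℕ) [NeZero m] :
    Twist n p m →ₗ[(ZMod p)[T;T⁻¹]] (Fin m × Fin n → (ZMod p)[T;T⁻¹]) :=
  let g : Twist n p m →+ (Fin m × Fin n → (ZMod p)[T;T⁻¹]) :=
    -- Since `(x^m ω)_i = ω_{i+m}`, multiplication by `T^a` moves an entry from place `i` to place
    -- `i - m a`; hence the minus sign.
    { toFun := fun w ij => AddMonoidAlgebra.ofCoeff
        (Finsupp.comapDomain (fun a : ℤ => (ij.1 : ℤ) - m * a)
          (Finsupp.mapRange (fun v : Fin n → ZMod p => v ij.2) rfl ((toTwist m).symm w))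
          (fun a _ b _ h => by simpa [NeZero.ne m] using h))
      map_zero' := by
        funext ij
        refine LaurentPolynomial.ext fun a => ?_
        rfl
      map_add' := fun w w' => by
        funext ij
        refine LaurentPolynomial.ext fun a => ?_
        rfl }
  { g with
    map_smul' := LaurentPolynomial.map_smul_of_map_T_smul (RingHom.id _) g (by
      intro b x
      obtain ⟨w, rfl⟩ := (toTwist m).surjective x
      rw [T_smul_toTwist]
      funext ij
      refine LaurentPolynomial.ext fun a => ?_
      have h : ∀ q : (ZMod p)[T;T⁻¹], (T b * q).coeff a = q.coeff (a - b) := by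
        intro q
        rw [T, AddMonoidAlgebra.coeff_single_mul_apply, one_mul, neg_add_eq_sub]
      refine Eq.trans ?_ (h (g (toTwist m w) ij)).symm
      change w ((ij.1 : ℤ) - m * a + m * b) ij.2 = w ((ij.1 : ℤ) - m * (a - b)) ij.2
      rw [mul_sub, sub_sub_eq_add_sub, add_sub_right_comm]) }

lemma twistCoord_apply (m : ℕ) [NeZero m] (w : LampBase n p) (ij : Fin m × Fin n) (a : ℤ) :
    (twistCoord n p m (toTwist m w) ij).coeff a = w ((ij.1 : ℤ) - m * a) ij.2 := rfl

lemma twistCoord_bijective (n p m : ℕ) [NeZero m] : Function.Bijective (twistCoord n p m) := by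
  have hm : 0 < (m : ℤ) := by exact_mod_cast Nat.pos_of_neZero m
  constructor
  · rw [← LinearMap.ker_eq_bot, LinearMap.ker_eq_bot']
    intro x hx
    obtain ⟨w, rfl⟩ := (toTwist m).surjective x
    have hw : w = 0 := by
      refine Finsupp.ext fun i => funext fun j => ?_
      have hlt := Int.emod_lt_of_pos i hm
      have hnn := Int.emod_nonneg i hm.ne'
      have h := twistCoord_apply m w (⟨(i % m).toNat, by omega⟩, j) (-(i / m))
      rw [hx] at h
      change 0 = w (((i % m).toNat : ℤ) - m * (-(i / m))) j at h
      rw [Int.toNat_of_nonneg hnn, mul_neg, sub_neg_eq_add, Int.emod_add_mul_ediv] at h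
      exact h.symm
    rw [hw, map_zero]
  · rw [← LinearMap.range_eq_top, eq_top_iff, ← (Pi.basisFun (ZMod p)[T;T⁻¹] _).span_eq,
      Submodule.span_le]
    rintro _ ⟨⟨i, j⟩, rfl⟩
    refine ⟨toTwist m (Finsupp.single (i : ℤ) (Pi.single j 1)), ?_⟩
    funext ij
    refine LaurentPolynomial.ext fun a => ?_
    rw [twistCoord_apply, Pi.basisFun_apply]
    by_cases hi : (i : ℤ) = (ij.1 : ℤ) - m * a
    · have ha : a = 0 := by
        have h1 := i.2
        have h2 := ij.1.2
        by_contra ha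
        rcases lt_or_gt_of_ne ha with h | h <;> nlinarith
      subst ha
      have hi' : ij.1 = i := by
        apply Fin.ext; simpa using hi.symm
      rw [← hi, Finsupp.single_eq_same]
      by_cases hj : ij.2 = j
      · have : ij = (i, j) := Prod.ext hi' hj
        rw [this]
        simp [← LaurentPolynomial.T_zero]
      · rw [Pi.single_eq_of_ne hj, Pi.single_eq_of_ne (fun h => hj (by rw [h]))]
        rfl
    · rw [Finsupp.single_eq_of_ne (Ne.symm hi)]
      by_cases hij : ij = (i, j)
      · subst hij
        have ha : a ≠ 0 := by rintro rfl; simp at hi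
        rw [Pi.single_eq_same, ← LaurentPolynomial.T_zero, LaurentPolynomial.T_apply,
          if_neg (Ne.symm ha)]
        rfl
      · rw [Pi.single_eq_of_ne hij]
        rfl

/-- `Twist n p m` is a free module of rank `m n`. -/
def twistEquiv (n p m : ℕ) [NeZero m] :
    Twist n p m ≃ₗ[(ZMod p)[T;T⁻¹]] (Fin m × Fin n → (ZMod p)[T;T⁻¹]) :=
  LinearEquiv.ofBijective _ (twistCoord_bijective n p m)

instance (m : ℕ) [NeZero m] : Module.Finite (ZMod p)[T;T⁻¹] (Twist n p m) :=
  Module.Finite.equiv (twistEquiv n p m).symm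

instance (m : ℕ) [NeZero m] : Module.Free (ZMod p)[T;T⁻¹] (Twist n p m) :=
  Module.Free.of_equiv (twistEquiv n p m).symm

lemma finrank_twist (n p m : ℕ) [NeZero m] [Fact p.Prime] :
    Module.finrank (ZMod p)[T;T⁻¹] (Twist n p m) = n * m := by
  rw [(twistEquiv n p m).finrank_eq, Module.finrank_fintype_fun_eq_card, Fintype.card_prod,
    Fintype.card_fin, Fintype.card_fin, mul_comm]

/-- The endomorphism of the ring of Laurent polynomials that maps `T` to `T^k`. -/
def laurentExpand (p k : ℕ) : (ZMod p)[T;T⁻¹] →+* (ZMod p)[T;T⁻¹] :=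
  AddMonoidAlgebra.mapDomainRingHom (ZMod p) (AddMonoidHom.mulLeft (k : ℤ))

lemma laurentExpand_T (k : ℕ) (b : ℤ) : laurentExpand p k (T b) = T (k * b) :=
  AddMonoidAlgebra.mapDomain_single

/-- The identity map from one copy of `A` to another one. -/
def twistChange (n p m k : ℕ) : Twist n p (m * k) ≃+ Twist n p m :=
  (toTwist (m * k)).symm.trans (toTwist m)

lemma twistChange_smul (m k : ℕ) (f : (ZMod p)[T;T⁻¹]) (x : Twist n p (m * k)) :
    twistChange n p m k (f • x) = laurentExpand p k f • twistChange n p m k x := by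
  refine LaurentPolynomial.map_smul_of_map_T_smul (laurentExpand p k)
    (twistChange n p m k).toAddMonoidHom (fun b x => ?_) f x
  obtain ⟨w, rfl⟩ := (toTwist (m * k)).surjective x
  rw [T_smul_toTwist, laurentExpand_T]
  refine Eq.trans ?_ (T_smul_toTwist m _ w).symm
  change toTwist m (shift n p ((m * k : ℕ) * b) w) = _
  rw [Nat.cast_mul, mul_assoc]

/-- `R` has rank `k` over itself through `T ↦ T^k`: identify `R` with `Twist 1 p 1`; restriction of
scalars turns it into `Twist 1 p (1 * k)`, which is free of rank `k`. A basis of `M` reduces the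
general case to this one. -/
lemma finrank_of_laurentExpand [Fact p.Prime] {M M' : Type*} [AddCommGroup M] [AddCommGroup M']
    [Module (ZMod p)[T;T⁻¹] M] [Module (ZMod p)[T;T⁻¹] M'] [Module.Free (ZMod p)[T;T⁻¹] M]
    [Module.Finite (ZMod p)[T;T⁻¹] M] (k : ℕ) [NeZero k] (g : M' ≃+ M)
    (hg : ∀ (f : (ZMod p)[T;T⁻¹]) (x : M'), g (f • x) = laurentExpand p k f • g x) :
    Module.finrank (ZMod p)[T;T⁻¹] M' = k * Module.finrank (ZMod p)[T;T⁻¹] M := by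
  let _ : Unique (Fin 1 × Fin 1) := ⟨⟨(0, 0)⟩, fun _ => Subsingleton.elim _ _⟩
  let σ : Twist 1 p 1 ≃ₗ[(ZMod p)[T;T⁻¹]] (ZMod p)[T;T⁻¹] :=
    (twistEquiv 1 p 1).trans (LinearEquiv.funUnique (Fin 1 × Fin 1) _ _)
  let δ : (ZMod p)[T;T⁻¹] ≃+ Twist 1 p (1 * k) :=
    σ.symm.toAddEquiv.trans (twistChange 1 p 1 k).symm
  have hδ : ∀ f x : (ZMod p)[T;T⁻¹], δ (laurentExpand p k f * x) = f • δ x := by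
    intro f x
    apply (twistChange 1 p 1 k).injective
    rw [twistChange_smul]
    change twistChange 1 p 1 k ((twistChange 1 p 1 k).symm (σ.symm (laurentExpand p k f • x))) =
      laurentExpand p k f • twistChange 1 p 1 k ((twistChange 1 p 1 k).symm (σ.symm x))
    rw [AddEquiv.apply_symm_apply, AddEquiv.apply_symm_apply, map_smul]
  let b := Module.finBasis (ZMod p)[T;T⁻¹] M
  let L : M' ≃ₗ[(ZMod p)[T;T⁻¹]]
      (Fin (Module.finrank (ZMod p)[T;T⁻¹] M) → Twist 1 p (1 * k)) :=
    { (g.trans b.equivFun.toAddEquiv).trans (AddEquiv.piCongrRight fun _ => δ) with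
      map_smul' := fun f x => by
        funext i
        change δ (b.equivFun (g (f • x)) i) = f • δ (b.equivFun (g x) i)
        rw [hg, map_smul, Pi.smul_apply, smul_eq_mul, hδ] }
  have : NeZero (1 * k) := ⟨by rw [one_mul]; exact NeZero.ne k⟩
  rw [L.finrank_eq, Module.finrank_pi_fintype]
  simp only [finrank_twist, Finset.sum_const, Finset.card_univ, Fintype.card_fin, smul_eq_mul,
    one_mul]
  rw [mul_comm]

lemma toTwist_mem_twistSpan {m : ℕ} {U : AddSubgroup (LampBase n p)} (h : IsPeriod U m)
    {w : LampBase n p} : toTwist m w ∈ twistSpan m U ↔ w ∈ U := by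
  rw [← SetLike.mem_coe, coe_twistSpan h, (toTwist m).injective.mem_set_image, SetLike.mem_coe]

lemma IsPeriod.shift_mem_iff {U : AddSubgroup (LampBase n p)} {m : ℕ} (h : IsPeriod U m)
    (a : ℤ) {w : LampBase n p} : shift n p (m * a) w ∈ U ↔ w ∈ U := by
  refine ⟨fun hw => ?_, h.shift_mem a⟩
  have h' := h.shift_mem (-a) hw
  have : shift n p (m * -a) (shift n p (m * a) w) = w :=
    Finsupp.ext fun i => by simp only [shift_apply]; congr 1; ring
  rwa [this] at h'

lemma isPeriod_iff {U : AddSubgroup (LampBase n p)} {m : ℕ} :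
    IsPeriod U m ↔ ∀ w, shift n p m w ∈ U ↔ w ∈ U := by
  refine ⟨fun h w => by simpa using h.shift_mem_iff 1 (w := w), fun h => ?_⟩
  refine le_antisymm ?_ fun w hw => ?_
  · rintro _ ⟨w, hw, rfl⟩
    exact (h w).2 hw
  · refine ⟨(shift n p m).symm w, ?_, (shift n p m).apply_symm_apply w⟩
    rw [SetLike.mem_coe, ← h, AddEquiv.apply_symm_apply]
    exact hw

lemma IsPeriod.mul {U : AddSubgroup (LampBase n p)} {m : ℕ} (h : IsPeriod U m) (k : ℕ) :
    IsPeriod U (m * k) := by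
  rw [isPeriod_iff]
  intro w
  rw [Nat.cast_mul]
  exact h.shift_mem_iff k

lemma rk_mul [Fact p.Prime] {U : AddSubgroup (LampBase n p)} {m : ℕ} [NeZero m]
    (h : IsPeriod U m) (k : ℕ)
    [NeZero k] : rk (m * k) U = k * rk m U := by
  have hmem : ∀ w, toTwist (m * k) w ∈ twistSpan (m * k) U ↔ toTwist m w ∈ twistSpan m U :=
    fun w => by rw [toTwist_mem_twistSpan h, toTwist_mem_twistSpan (h.mul k)]
  exact finrank_of_laurentExpand k
    { toFun := fun x => ⟨twistChange n p m k x.1, (hmem _).1 x.2⟩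
      invFun := fun x => ⟨(twistChange n p m k).symm x.1, (hmem _).2 x.2⟩
      left_inv := fun _ => rfl
      right_inv := fun _ => rfl
      map_add' := fun _ _ => rfl }
    (fun f x => Subtype.ext (twistChange_smul m k f x.1))

/-- The rank of `A / U` as an `R`-module via `x * u = x^m u`. -/
def corank (m : ℕ) (U : AddSubgroup (LampBase n p)) : ℕ :=
  Module.finrank (ZMod p)[T;T⁻¹] (Twist n p m ⧸ twistSpan m U)

lemma corank_add_rk [Fact p.Prime] (m : ℕ) [NeZero m] (U : AddSubgroup (LampBase n p)) :
    corank m U + rk m U = n * m := by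
  rw [← finrank_twist n p m]
  exact Submodule.finrank_quotient_add_finrank _

lemma corank_mul [Fact p.Prime] {U : AddSubgroup (LampBase n p)} {m : ℕ} [NeZero m]
    (h : IsPeriod U m) (k : ℕ)
    [NeZero k] : corank (m * k) U = k * corank m U := by
  have : NeZero (m * k) := ⟨mul_ne_zero (NeZero.ne m) (NeZero.ne k)⟩
  have h1 := corank_add_rk (m * k) U
  have h2 := corank_add_rk m U
  rw [rk_mul h k] at h1
  have h3 : k * corank m U + k * rk m U = n * (m * k) := by
    rw [← mul_add, h2]; ring
  omega

/-- Ranks add in `N ≤ N'`, so `N' / N` has rank zero and is torsion. -/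
lemma Submodule.exists_smul_mem_of_finrank_le {R M : Type*} [CommRing R] [IsDomain R]
    [IsNoetherianRing R] [AddCommGroup M] [Module R M] [Module.Finite R M] {N N' : Submodule R M}
    (hle : N ≤ N') (h : Module.finrank R N' ≤ Module.finrank R N) {x : M} (hx : x ∈ N') :
    ∃ a : R, a ≠ 0 ∧ a • x ∈ N := by
  have h1 := Submodule.finrank_quotient_add_finrank (N.submoduleOf N')
  rw [(Submodule.submoduleOfEquivOfLe hle).finrank_eq] at h1
  have h2 : Module.IsTorsion R (N' ⧸ N.submoduleOf N') := by
    rw [← Module.finrank_eq_zero_iff_isTorsion]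
    omega
  obtain ⟨a, ha⟩ := @h2 (Submodule.Quotient.mk ⟨x, hx⟩)
  refine ⟨a, nonZeroDivisors.coe_ne_zero a, ?_⟩
  have ha' : (a : R) • (Submodule.Quotient.mk ⟨x, hx⟩ : N' ⧸ N.submoduleOf N') = 0 := ha
  rw [← Submodule.Quotient.mk_smul, Submodule.Quotient.mk_eq_zero] at ha'
  exact ha'

lemma twistSpan_mono (m : ℕ) {U U' : AddSubgroup (LampBase n p)} (h : U ≤ U') :
    twistSpan m U ≤ twistSpan m U' :=
  Submodule.span_mono (Set.image_mono h)

lemma exists_smul_mem_of_corank_le [Fact p.Prime] (m : ℕ) [NeZero m] {U U' : AddSubgroup (LampBase n p)}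
    (h : U ≤ U') (hc : corank m U ≤ corank m U') {w : LampBase n p} (hw : w ∈ U') :
    ∃ a : (ZMod p)[T;T⁻¹], a ≠ 0 ∧ a • toTwist m w ∈ twistSpan m U := by
  have h1 := corank_add_rk m U
  have h2 := corank_add_rk m U'
  exact Submodule.exists_smul_mem_of_finrank_le (twistSpan_mono m h)
    (show rk m U' ≤ rk m U by omega) (Submodule.subset_span ⟨w, hw, rfl⟩)

end TwistModule

/-! ### Convergence of subgroups, tested on one element at a time. -/

section SubgroupSpace

variable {G : Type*} [Group G]

lemma eventually_mem_subgroup_iff (H : Subgroup G) (g : G) :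
    ∀ᶠ W in 𝓝 H, (g ∈ W ↔ g ∈ H) := by
  have hc : Continuous fun W : Subgroup G => subgroupChar W g :=
    Continuous.comp (g := fun f : G → Bool => f g) (continuous_apply g)
      (continuous_induced_dom (f := subgroupChar))
  filter_upwards [hc.continuousAt.eventually 
    ((isOpen_discrete {subgroupChar H g}).mem_nhds rfl)] with W hW
  exact decide_eq_decide.1 hW

lemma tendsto_subgroup_of_eventually {ι : Type*} {l : Filter ι} {W : ι → Subgroup G}
    {H : Subgroup G} (h : ∀ g, ∀ᶠ i in l, (g ∈ W i ↔ g ∈ H)) : Tendsto W l (𝓝 H) := by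
  rw [nhds_induced, tendsto_comap_iff, tendsto_pi_nhds]
  intro g
  refine tendsto_nhds_of_eventually_eq ?_
  filter_upwards [h g] with i hi
  exact decide_eq_decide.2 hi

end SubgroupSpace

/-! ### Subgroups of the lamplighter group through `U`, `s` and `e`. -/

section Lamp

variable {n p : ℕ}

lemma lampMk_mul (v w : LampBase n p) (s t : ℤ) :
    lampMk v s * lampMk w t = lampMk (v + shift n p s w) (s + t) := rfl

lemma shift_add (s t : ℤ) (w : LampBase n p) :
    shift n p (s + t) w = shift n p s (shift n p t w) :=
  Finsupp.ext fun i => by simp only [shift_apply, add_assoc]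

lemma shift_zero (w : LampBase n p) : shift n p 0 w = w :=
  Finsupp.ext fun i => by rw [shift_apply, add_zero]

lemma lampMk_inv (v : LampBase n p) (s : ℤ) :
    (lampMk v s)⁻¹ = lampMk (-shift n p (-s) v) (-s) := by
  rw [inv_eq_iff_mul_eq_one, lampMk_mul, map_neg, ← shift_add, add_neg_cancel, shift_zero,
    add_neg_cancel]
  rfl

lemma exists_eq_lampMk (g : Lamplighter n p) : ∃ v k, g = lampMk v k :=
  ⟨g.left.toAdd, g.right.toAdd, rfl⟩

lemma lampMk_inj {v w : LampBase n p} {s t : ℤ} : lampMk v s = lampMk w t ↔ v = w ∧ s = t := by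
  refine ⟨fun h => ⟨?_, ?_⟩, fun h => by rw [h.1, h.2]⟩
  · exact congrArg (fun g : Lamplighter n p => g.left.toAdd) h
  · exact congrArg (fun g : Lamplighter n p => g.right.toAdd) h

lemma mem_basePart {V : Subgroup (Lamplighter n p)} {w : LampBase n p} :
    w ∈ basePart V ↔ lampMk w 0 ∈ V := Iff.rfl

lemma lampMk_add_mem_iff {V : Subgroup (Lamplighter n p)} {w u : LampBase n p} {k : ℤ}
    (h : lampMk w k ∈ V) : lampMk (u + w) k ∈ V ↔ u ∈ basePart V := by
  have : lampMk (u + w) k = lampMk u 0 * lampMk w k := by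
    rw [lampMk_mul, shift_zero, zero_add]
  rw [this, V.mul_mem_cancel_right h, mem_basePart]

lemma dvd_of_lampMk_mem {V : Subgroup (Lamplighter n p)} {w : LampBase n p} {k : ℤ}
    (h : lampMk w k ∈ V) : (projGen V : ℤ) ∣ k := (projGen_spec V k).1 ⟨w, h⟩

lemma basePart_mono {V W : Subgroup (Lamplighter n p)} (h : V ≤ W) : basePart V ≤ basePart W :=
  fun _ hw => h hw

lemma projGen_dvd {V W : Subgroup (Lamplighter n p)} (h : V ≤ W) : projGen W ∣ projGen V := by
  obtain ⟨v, hv⟩ := (projGen_spec V (projGen V)).2 dvd_rfl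
  exact Int.natCast_dvd_natCast.1 (dvd_of_lampMk_mem (h hv))

/-- The subgroup `U' V`, for a subgroup `U'` of `A` that is invariant under the projection
of `V`. -/
def enlarge (V : Subgroup (Lamplighter n p)) (U' : AddSubgroup (LampBase n p))
    (h : IsPeriod U' (projGen V)) : Subgroup (Lamplighter n p) where
  carrier := {g | ∃ u ∈ U', ∃ w k, g = lampMk (u + w) k ∧ lampMk w k ∈ V}
  one_mem' := ⟨0, zero_mem _, 0, 0, by rw [add_zero]; rfl, V.one_mem⟩
  mul_mem' := by
    rintro _ _ ⟨u, hu, w, k, rfl, hw⟩ ⟨u', hu', w', k', rfl, hw'⟩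
    obtain ⟨a, rfl⟩ := dvd_of_lampMk_mem hw
    have h1 := V.mul_mem hw hw'
    rw [lampMk_mul] at h1
    refine ⟨_, add_mem hu (h.shift_mem a hu'), _, _, ?_, h1⟩
    rw [lampMk_mul, map_add, add_add_add_comm]
  inv_mem' := by
    rintro _ ⟨u, hu, w, k, rfl, hw⟩
    obtain ⟨a, rfl⟩ := dvd_of_lampMk_mem hw
    have h1 := V.inv_mem hw
    rw [lampMk_inv] at h1
    refine ⟨_, neg_mem (h.shift_mem (-a) hu), _, _, ?_, h1⟩
    rw [lampMk_inv, map_add, mul_neg]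
    congr 1
    abel

variable {V : Subgroup (Lamplighter n p)} {U' : AddSubgroup (LampBase n p)}
  {h : IsPeriod U' (projGen V)}

lemma mem_enlarge {v : LampBase n p} {k : ℤ} :
    lampMk v k ∈ enlarge V U' h ↔ ∃ u ∈ U', lampMk (v - u) k ∈ V := by
  constructor
  · rintro ⟨u, hu, w, l, e, hw⟩
    obtain ⟨rfl, rfl⟩ := lampMk_inj.1 e
    exact ⟨u, hu, by rwa [add_sub_cancel_left]⟩
  · rintro ⟨u, hu, hv⟩
    exact ⟨u, hu, _, _, by rw [add_sub_cancel], hv⟩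

lemma le_enlarge : V ≤ enlarge V U' h := by
  intro g hg
  obtain ⟨v, k, rfl⟩ := exists_eq_lampMk g
  exact mem_enlarge.2 ⟨0, zero_mem _, by rwa [sub_zero]⟩

lemma projGen_enlarge : projGen (enlarge V U' h) = projGen V := by
  have : ∀ k : ℤ, (projGen (enlarge V U' h) : ℤ) ∣ k ↔ (projGen V : ℤ) ∣ k := by
    intro k
    rw [← projGen_spec, ← projGen_spec]
    constructor
    · rintro ⟨v, hv⟩
      obtain ⟨u, -, hu⟩ := mem_enlarge.1 hv
      exact ⟨_, hu⟩
    · rintro ⟨v, hv⟩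
      exact ⟨v, le_enlarge hv⟩
  exact Nat.dvd_antisymm (Int.natCast_dvd_natCast.1 ((this _).2 dvd_rfl))
    (Int.natCast_dvd_natCast.1 ((this _).1 dvd_rfl))

lemma basePart_enlarge (hU : basePart V ≤ U') : basePart (enlarge V U' h) = U' := by
  ext w
  rw [mem_basePart, mem_enlarge]
  constructor
  · rintro ⟨u, hu, hw⟩
    have := add_mem (hU hw) hu
    rwa [sub_add_cancel] at this
  · intro hw
    exact ⟨w, hw, by rw [sub_self]; exact V.one_mem⟩

lemma mem_ZSet_of_le {V W : Subgroup (Lamplighter n p)} (hV : V ∈ ZSet n p) (h : V ≤ W) :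
    W ∈ ZSet n p := fun hW => hV (h.trans hW)

lemma period_dvd {U : AddSubgroup (LampBase n p)} (hU : 0 < period U) {d : ℕ}
    (hd : IsPeriod U d) : period U ∣ d := by
  -- The infimum of the empty set is `0`, which `hU` excludes.
  have hne : {e | 0 < e ∧ IsPeriod U e}.Nonempty := by
    by_contra hne
    rw [Set.not_nonempty_iff_eq_empty] at hne
    rw [period, hne, Nat.sInf_empty] at hU
    exact lt_irrefl _ hU
  have he : IsPeriod U (period U) := (Nat.sInf_mem hne).2
  by_contra hdvd
  have hpos : 0 < d % period U := Nat.pos_of_ne_zero fun h0 => hdvd (Nat.dvd_of_mod_eq_zero h0)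
  refine (Nat.mod_lt d hU).not_ge (Nat.sInf_le ⟨hpos, isPeriod_iff.2 fun w => ?_⟩)
  rw [← isPeriod_iff.1 hd w, ← he.shift_mem_iff (d / period U : ℕ), ← shift_add]
  have : (period U : ℤ) * (d / period U : ℕ) + (d % period U : ℕ) = d := by
    exact_mod_cast Nat.div_add_mod d (period U)
  rw [this]

lemma isPeriod_period {V : Subgroup (Lamplighter n p)} (hV : V ∈ ZSet n p) :
    IsPeriod (basePart V) (period (basePart V)) :=
  (Nat.sInf_mem (s := {e | 0 < e ∧ IsPeriod (basePart V) e})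
    ⟨_, projGen_pos hV, isPeriod_projGen V⟩).2

lemma period_dvd_projGen {V : Subgroup (Lamplighter n p)} (hV : V ∈ ZSet n p) :
    period (basePart V) ∣ projGen V :=
  period_dvd (period_pos hV).1 (isPeriod_projGen V)

lemma period_mul_Phi_t (V : ZSet n p) :
    period (basePart V.1) * ((Phi V).t : ℕ) = projGen V.1 :=
  Nat.mul_div_cancel' (period_dvd_projGen V.2)

/-- Rank and corank add up to `n e`, so the truncated subtraction in `Phi` is a true one. -/
lemma Phi_r [Fact p.Prime] (V : ZSet n p) :
    (Phi V).r = corank (period (basePart V.1)) (basePart V.1) := by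
  have : NeZero (period (basePart V.1)) := ⟨(period_pos V.2).1.ne'⟩
  have := corank_add_rk (period (basePart V.1)) (basePart V.1)
  change n * _ - _ = _
  omega

/-- Passing from `x^e` to `x^s = (x^e)^t` multiplies the corank by `t`. The product thus depends on
`s` and `U` only and can be compared along inclusions. -/
lemma Phi_t_mul_r [Fact p.Prime] (V : ZSet n p) :
    ((Phi V).t : ℕ) * (Phi V).r = corank (projGen V.1) (basePart V.1) := by
  have : NeZero (period (basePart V.1)) := ⟨(period_pos V.2).1.ne'⟩
  have : NeZero ((Phi V).t : ℕ) := ⟨(Phi V).t.pos.ne'⟩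
  rw [Phi_r, ← corank_mul (isPeriod_period V.2), period_mul_Phi_t]

end Lamp

/-! ### Subgroups close to `V` contain `V` and have smaller `Φ`. -/

section Neighbourhood

open scoped LaurentPolynomial
open LaurentPolynomial (T)

variable {n p : ℕ}

lemma IsPeriod.of_projGen_dvd {W : Subgroup (Lamplighter n p)} {d : ℕ} (h : projGen W ∣ d) :
    IsPeriod (basePart W) d := by
  obtain ⟨c, rfl⟩ := h
  exact (isPeriod_projGen W).mul c

lemma le_of_lampMk_mem {V W : Subgroup (Lamplighter n p)} {v : LampBase n p}
    (hvV : lampMk v (projGen V) ∈ V) (hvW : lampMk v (projGen V) ∈ W)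
    (h : basePart V ≤ basePart W) : V ≤ W := by
  intro g hg
  obtain ⟨w, k, rfl⟩ := exists_eq_lampMk g
  obtain ⟨a, rfl⟩ := dvd_of_lampMk_mem hg
  have hpow : ∃ v', lampMk v (projGen V) ^ a = lampMk v' (projGen V * a) := by
    refine ⟨((lampMk v (projGen V)) ^ a).left.toAdd, SemidirectProduct.ext rfl ?_⟩
    have := map_zpow (SemidirectProduct.rightHom : Lamplighter n p →* _) (lampMk v (projGen V)) a
    refine this.trans ?_
    change Multiplicative.ofAdd (projGen V : ℤ) ^ a = Multiplicative.ofAdd ((projGen V : ℤ) * a)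
    rw [← ofAdd_zsmul, smul_eq_mul, mul_comm]
  obtain ⟨v', hv'⟩ := hpow
  have h1 := V.zpow_mem hvV a
  have h2 := W.zpow_mem hvW a
  rw [hv'] at h1 h2
  rw [← sub_add_cancel w v', lampMk_add_mem_iff h1] at hg
  rw [← sub_add_cancel w v', lampMk_add_mem_iff h2]
  exact h hg

/-- An element `(v,s)` and finitely many module generators of `U` suffice. Once `(v,s) ∈ W`, the
group `W ∩ A` is stable under `x^s`, so it contains the submodule as soon as it contains its
generators. -/
lemma eventually_le_of_mem_ZSet [Fact p.Prime] {V : Subgroup (Lamplighter n p)}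
    (hV : V ∈ ZSet n p) : ∀ᶠ W in 𝓝 V, V ≤ W := by
  have : NeZero (projGen V) := ⟨(projGen_pos hV).ne'⟩
  obtain ⟨S, hS⟩ := IsNoetherian.noetherian (twistSpan (projGen V) (basePart V))
  obtain ⟨v, hv⟩ := (projGen_spec V (projGen V)).2 dvd_rfl
  have hSV : ∀ x ∈ S, (toTwist (projGen V)).symm x ∈ basePart V := by
    intro x hx
    rw [← toTwist_mem_twistSpan (isPeriod_projGen V), AddEquiv.apply_symm_apply, ← hS]
    exact Submodule.subset_span hx
  filter_upwards [eventually_mem_subgroup_iff V (lampMk v (projGen V)),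
    (Filter.eventually_all_finset S).2 fun x _ =>
      eventually_mem_subgroup_iff V (lampMk ((toTwist (projGen V)).symm x) 0)] with W hW hWS
  have hvW := hW.2 hv
  have hper : IsPeriod (basePart W) (projGen V) :=
    IsPeriod.of_projGen_dvd (Int.natCast_dvd_natCast.1 (dvd_of_lampMk_mem hvW))
  refine le_of_lampMk_mem hv hvW fun u hu => ?_
  rw [← toTwist_mem_twistSpan hper]
  have hle : twistSpan (projGen V) (basePart V) ≤ twistSpan (projGen V) (basePart W) := by
    rw [← hS, Submodule.span_le]
    intro x hx
    rw [← (toTwist (projGen V)).apply_symm_apply x, SetLike.mem_coe, toTwist_mem_twistSpan hper]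
    exact (hWS x hx).2 (hSV x hx)
  exact hle ((toTwist_mem_twistSpan (isPeriod_projGen V)).2 hu)

lemma eventually_isPeriod_imp (V : Subgroup (Lamplighter n p)) (d : ℕ) :
    ∀ᶠ W in 𝓝 V, V ≤ W → IsPeriod (basePart W) d → IsPeriod (basePart V) d := by
  by_cases hd : IsPeriod (basePart V) d
  · exact Eventually.of_forall fun _ _ _ => hd
  · rw [isPeriod_iff, not_forall] at hd
    obtain ⟨w, hw⟩ := hd
    filter_upwards [eventually_mem_subgroup_iff V (lampMk w 0),
      eventually_mem_subgroup_iff V (lampMk (shift n p d w) 0)] with W h1 h2 _ hW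
    refine absurd ?_ hw
    rw [mem_basePart, mem_basePart, ← h1, ← h2]
    exact isPeriod_iff.1 hW w

/-- The torsion submodule of `A / U` is finitely generated over `𝔽_p[x,x⁻¹]`, hence finite. A
condition on all torsion elements thus becomes a condition on finitely many elements, that is, an
open one. -/
lemma exists_finite_torsion_representatives [Fact p.Prime] (m : ℕ) [NeZero m]
    {U : AddSubgroup (LampBase n p)} (hU : IsPeriod U m) :
    ∃ F : Finset (LampBase n p), ∀ (w : LampBase n p) (a : (ZMod p)[T;T⁻¹]), a ≠ 0 →
      a • toTwist m w ∈ twistSpan m U → ∃ f ∈ F, w - f ∈ U := by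
  let Q := Twist n p m ⧸ twistSpan m U
  have hfin : Finite (Submodule.torsion (ZMod p)[T;T⁻¹] Q) := by
    refine LaurentPolynomial.finite_of_isTorsion (K := ZMod p) _ fun x => ?_
    obtain ⟨a, ha⟩ := @Submodule.torsion_isTorsion (ZMod p)[T;T⁻¹] Q _ _ _ x
    exact ⟨a, nonZeroDivisors.coe_ne_zero a, ha⟩
  choose l hl using (twistSpan m U).mkQ_surjective
  let F := (Set.finite_range fun x : Submodule.torsion (ZMod p)[T;T⁻¹] Q =>
    (toTwist m).symm (l x.1)).toFinset
  refine ⟨F, fun w a ha hw => ?_⟩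
  have htor : (twistSpan m U).mkQ (toTwist m w) ∈ Submodule.torsion (ZMod p)[T;T⁻¹] Q := by
    rw [Submodule.mem_torsion_iff]
    refine ⟨⟨a, mem_nonZeroDivisors_of_ne_zero ha⟩, ?_⟩
    change a • (twistSpan m U).mkQ (toTwist m w) = 0
    rw [← map_smul]
    exact (Submodule.Quotient.mk_eq_zero _).2 hw
  refine ⟨_, (Set.Finite.mem_toFinset _).2 ⟨⟨_, htor⟩, rfl⟩, ?_⟩
  rw [← toTwist_mem_twistSpan hU, map_sub, AddEquiv.apply_symm_apply]
  exact (Submodule.Quotient.eq _).1 (hl ((twistSpan m U).mkQ (toTwist m w))).symm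

lemma eventually_mem_of_smul_mem [Fact p.Prime] {V : Subgroup (Lamplighter n p)}
    (hV : V ∈ ZSet n p) : ∀ᶠ W in 𝓝 V, V ≤ W → ∀ w ∈ basePart W, ∀ a : (ZMod p)[T;T⁻¹], a ≠ 0 →
      a • toTwist (projGen V) w ∈ twistSpan (projGen V) (basePart V) → w ∈ basePart V := by
  have : NeZero (projGen V) := ⟨(projGen_pos hV).ne'⟩
  obtain ⟨F, hF⟩ := exists_finite_torsion_representatives (projGen V) (isPeriod_projGen V)
  filter_upwards [(Filter.eventually_all_finset F).2 fun f _ =>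
    eventually_mem_subgroup_iff V (lampMk f 0)] with W hW hVW w hw a ha haw
  obtain ⟨f, hf, hwf⟩ := hF w a ha haw
  have h1 : f ∈ basePart W := by
    have := sub_mem hw (basePart_mono hVW hwf)
    rwa [sub_sub_cancel] at this
  have := add_mem hwf ((hW f hf).1 h1)
  rwa [sub_add_cancel] at this

/-- If `(v',s') ∈ W` with `s' < s`, its two products with `(v,s)` differ by an element of `W ∩ A =
U`. This determines `v'` modulo `U` up to the kernel of `x^s - 1` on `A / U`, which is torsion. So
finitely many elements decide whether such a `W` exists, and none of them lies in `V`. -/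
lemma eventually_projGen_eq [Fact p.Prime] {V : Subgroup (Lamplighter n p)}
    (hV : V ∈ ZSet n p) :
    ∀ᶠ W in 𝓝 V, V ≤ W → basePart W = basePart V → projGen W = projGen V := by
  have : NeZero (projGen V) := ⟨(projGen_pos hV).ne'⟩
  obtain ⟨F, hF⟩ := exists_finite_torsion_representatives (projGen V) (isPeriod_projGen V)
  obtain ⟨v, hv⟩ := (projGen_spec V (projGen V)).2 dvd_rfl
  -- A particular solution is fixed for each `s'` before `W` is given, so that the neighbourhood
  -- depends on `V` alone; `0` is a dummy value when there is no solution.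
  have hsol : ∀ s' : ℕ, ∃ v₀ : LampBase n p, ∀ v' : LampBase n p,
      v' + shift n p s' v - (v + shift n p (projGen V) v') ∈ basePart V →
      v₀ + shift n p s' v - (v + shift n p (projGen V) v₀) ∈ basePart V := by
    intro s'
    by_cases h : ∃ v' : LampBase n p,
      v' + shift n p s' v - (v + shift n p (projGen V) v') ∈ basePart V
    · exact ⟨h.choose, fun _ _ => h.choose_spec⟩
    · exact ⟨0, fun v' hv' => absurd ⟨v', hv'⟩ h⟩
  choose v₀ hv₀ using hsol
  filter_upwards [(Filter.eventually_all_finset (Finset.range (projGen V))).2 fun s' _ =>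
    (Filter.eventually_all_finset F).2 fun f _ =>
      eventually_mem_subgroup_iff V (lampMk (v₀ s' + f) s')] with W hW hVW hbase
  by_contra hne
  have hdvd := projGen_dvd hVW
  have hlt : projGen W < projGen V :=
    lt_of_le_of_ne (Nat.le_of_dvd (projGen_pos hV) hdvd) hne
  obtain ⟨v', hv'⟩ := (projGen_spec W (projGen W)).2 dvd_rfl
  have h1 := W.mul_mem hv' (hVW hv)
  have h2 := W.mul_mem (hVW hv) hv'
  rw [lampMk_mul] at h1 h2
  rw [add_comm (projGen V : ℤ)] at h2
  rw [← sub_add_cancel (v' + shift n p (projGen W) v) (v + shift n p (projGen V) v'),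
    lampMk_add_mem_iff h2, hbase] at h1
  have h3 := sub_mem (hv₀ _ _ h1) h1
  have h4 : (T 1 - 1 : (ZMod p)[T;T⁻¹]) • toTwist (projGen V) (v' - v₀ (projGen W)) ∈
      twistSpan (projGen V) (basePart V) := by
    rw [sub_smul, one_smul, T_smul_toTwist, ← map_sub,
      toTwist_mem_twistSpan (isPeriod_projGen V), mul_one, map_sub]
    convert h3 using 1
    abel
  obtain ⟨f, hf, hwf⟩ := hF _ _ LaurentPolynomial.T_sub_one_ne_zero h4
  have h5 : lampMk (v₀ (projGen W) + f) (projGen W) ∈ W := by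
    rw [← hbase, sub_sub, ← neg_sub, neg_mem_iff] at hwf
    have := (lampMk_add_mem_iff hv').2 hwf
    rwa [sub_add_cancel] at this
  have h6 := dvd_of_lampMk_mem ((hW _ (Finset.mem_range.2 hlt) f hf).1 h5)
  exact hlt.not_ge (Nat.le_of_dvd (projGen_pos (mem_ZSet_of_le hV hVW))
    (Int.natCast_dvd_natCast.1 h6))

lemma eq_of_basePart_eq {V W : Subgroup (Lamplighter n p)} (h : V ≤ W)
    (hb : basePart W = basePart V) (hs : projGen W = projGen V) : W = V := by
  obtain ⟨v, hv⟩ := (projGen_spec V (projGen V)).2 dvd_rfl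
  have hv' : lampMk v (projGen W) ∈ V := by rwa [hs]
  exact le_antisymm (le_of_lampMk_mem (hs ▸ h hv) hv' hb.le) h

theorem eventually_le_and_Phi_lt [Fact p.Prime] (V : ZSet n p) :
    ∀ᶠ W in 𝓝 V, V.1 ≤ W.1 ∧ (W ≠ V → Phi W < Phi V) := by
  have hval : Tendsto Subtype.val (𝓝 V) (𝓝 V.1) := continuous_subtype_val.tendsto V
  filter_upwards [hval.eventually (eventually_le_of_mem_ZSet V.2),
    hval.eventually (eventually_mem_of_smul_mem V.2),
    hval.eventually (eventually_projGen_eq V.2),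
    -- Finitely many `d` suffice because `e_W ≤ s_W ≤ s_V`.
    hval.eventually ((Filter.eventually_all_finset (Finset.range (projGen V.1 + 1))).2 fun d _ =>
      eventually_isPeriod_imp V.1 d)] with W hle htor hproj hper
  refine ⟨hle, fun hne => ?_⟩
  have hdvd := projGen_dvd hle
  have hsV := projGen_pos V.2
  have : NeZero (projGen V.1) := ⟨hsV.ne'⟩
  have : NeZero (projGen W.1) := ⟨(projGen_pos W.2).ne'⟩
  have hperiod : period (basePart V.1) ∣ period (basePart W.1) := by
    refine period_dvd (period_pos V.2).1 (hper _ ?_ hle (isPeriod_period W.2))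
    rw [Finset.mem_range, Nat.lt_succ_iff]
    exact (period_pos W.2).2.trans (Nat.le_of_dvd hsV hdvd)
  obtain ⟨c, hc⟩ := hdvd
  constructor
  · obtain ⟨b, hb⟩ := hperiod
    have h1 := period_mul_Phi_t V
    have h2 := period_mul_Phi_t W
    refine ⟨b * c, Nat.eq_of_mul_eq_mul_left (period_pos V.2).1 ?_⟩
    rw [h1, hc, ← h2, hb]
    ring
  -- With `s_V = c s_W`: passing from `x^(s_W)` to `x^(s_V)` multiplies the corank of `U_W` by `c ≥
  -- 1`. If this left no strict drop from `U_V`, then `U_W / U_V` would be torsion, hence zero.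
  · rw [Phi_t_mul_r, Phi_t_mul_r]
    have : NeZero c := ⟨by rintro rfl; rw [mul_zero] at hc; omega⟩
    have h1 := corank_mul (isPeriod_projGen W.1) c
    rw [← hc] at h1
    have h2 : corank (projGen W.1) (basePart W.1) ≤ corank (projGen V.1) (basePart W.1) := by
      rw [h1]
      exact Nat.le_mul_of_pos_left _ (Nat.pos_of_neZero c)
    refine h2.trans_lt ?_
    by_contra! h3
    have hb : basePart W.1 = basePart V.1 := by
      refine le_antisymm (fun w hw => ?_) (basePart_mono hle)
      obtain ⟨a, ha, haw⟩ := exists_smul_mem_of_corank_le (projGen V.1) (basePart_mono hle) h3 hw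
      exact htor hle w hw a ha haw
    exact hne (Subtype.ext (eq_of_basePart_eq hle hb (hproj hle hb)))

end Neighbourhood

/-! ### Coordinates modulo torsion, and submodules spanned by multiples of coordinate vectors. -/

section Coordinates

variable {R M : Type*} [CommRing R] [AddCommGroup M] [Module R M]

/-- Over a principal ideal domain, `M / N` modulo its torsion is free; `π` reads off coordinates
there. -/
lemma Submodule.exists_coordinates_modulo_torsion [IsDomain R] [IsPrincipalIdealRing R]
    [Module.Finite R M] (N : Submodule R M) :
    ∃ π : M →ₗ[R] (Fin (Module.finrank R (M ⧸ N)) → R), Function.Surjective π ∧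
      ∀ x, π x = 0 ↔ ∃ a : R, a ≠ 0 ∧ a • x ∈ N := by
  let F := (M ⧸ N) ⧸ Submodule.torsion R (M ⧸ N)
  have : Module.Free R F := Module.free_iff_isTorsionFree.2 inferInstance
  have hrank : Module.finrank R F = Module.finrank R (M ⧸ N) := by
    have h0 : Module.finrank R (Submodule.torsion R (M ⧸ N)) = 0 :=
      Module.finrank_eq_zero_iff_isTorsion.2 Submodule.torsion_isTorsion
    rw [← Submodule.finrank_quotient_add_finrank (Submodule.torsion R (M ⧸ N)), h0, add_zero]
  let b : Module.Basis (Fin (Module.finrank R (M ⧸ N))) R F :=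
    (Module.finBasis R F).reindex (finCongr hrank)
  refine ⟨b.equivFun.toLinearMap ∘ₗ (Submodule.torsion R (M ⧸ N)).mkQ ∘ₗ N.mkQ, ?_, fun x => ?_⟩
  · exact b.equivFun.surjective.comp ((Submodule.mkQ_surjective _).comp (Submodule.mkQ_surjective _))
  · change b.equivFun ((Submodule.torsion R (M ⧸ N)).mkQ (N.mkQ x)) = 0 ↔ _
    rw [LinearEquiv.map_eq_zero_iff, Submodule.mkQ_apply, Submodule.Quotient.mk_eq_zero,
      Submodule.mem_torsion_iff]
    have key : ∀ a : R, a • N.mkQ x = 0 ↔ a • x ∈ N := fun a => by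
      rw [← map_smul, Submodule.mkQ_apply, Submodule.Quotient.mk_eq_zero]
    constructor
    · rintro ⟨a, ha⟩
      exact ⟨a, nonZeroDivisors.coe_ne_zero a, (key _).1 ha⟩
    · rintro ⟨a, ha, hax⟩
      exact ⟨⟨a, mem_nonZeroDivisors_of_ne_zero ha⟩, (key _).2 hax⟩

variable {ι κ : Type*} [Fintype ι] [DecidableEq κ] {N : Submodule R M} {π : M →ₗ[R] (κ → R)}
  {y : ι → M} {g : ι → R} {e : ι → κ}

lemma Submodule.mem_sup_span_range_iff {x : M} :
    x ∈ N ⊔ Submodule.span R (Set.range y) ↔ ∃ z ∈ N, ∃ a : ι → R, x = z + ∑ i, a i • y i := by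
  rw [Submodule.mem_sup]
  constructor
  · rintro ⟨z, hz, w, hw, rfl⟩
    obtain ⟨a, rfl⟩ := (Submodule.mem_span_range_iff_exists_fun R).1 hw
    exact ⟨z, hz, a, rfl⟩
  · rintro ⟨z, hz, a, rfl⟩
    exact ⟨z, hz, _, (Submodule.mem_span_range_iff_exists_fun R).2 ⟨a, rfl⟩, rfl⟩

lemma map_add_sum_smul_apply (hN : ∀ z ∈ N, π z = 0) (hy : ∀ i, π (y i) = Pi.single (e i) (g i))
    {z : M} (hz : z ∈ N) (a : ι → R) (k : κ) :
    π (z + ∑ i, a i • y i) k = ∑ i, if e i = k then a i * g i else 0 := by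
  rw [map_add, hN z hz, zero_add, map_sum, Finset.sum_apply]
  refine Finset.sum_congr rfl fun i _ => ?_
  rw [map_smul, hy, Pi.smul_apply, Pi.single_apply, smul_eq_mul, mul_ite, mul_zero]
  simp only [eq_comm]

lemma dvd_apply_of_mem_sup_span (hN : ∀ z ∈ N, π z = 0)
    (hy : ∀ i, π (y i) = Pi.single (e i) (g i)) {x : M}
    (hx : x ∈ N ⊔ Submodule.span R (Set.range y)) {k : κ} {h : R}
    (hk : ∀ i, e i = k → h ∣ g i) : h ∣ π x k := by
  obtain ⟨z, hz, a, rfl⟩ := Submodule.mem_sup_span_range_iff.1 hx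
  rw [map_add_sum_smul_apply hN hy hz]
  refine Finset.dvd_sum fun i _ => ?_
  split_ifs with hi
  · exact (hk i hi).mul_left _
  · exact dvd_zero _

lemma coeff_eq_zero_of_map_eq_zero [IsDomain R] (hN : ∀ z ∈ N, π z = 0)
    (he : Function.Injective e)
    (hg : ∀ i, g i ≠ 0) (hy : ∀ i, π (y i) = Pi.single (e i) (g i)) {z : M} (hz : z ∈ N)
    {a : ι → R} (hx : π (z + ∑ i, a i • y i) = 0) (i : ι) : a i = 0 := by
  classical
  have h := congrFun hx (e i)
  rw [map_add_sum_smul_apply hN hy hz] at h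
  simp only [he.eq_iff, Finset.sum_ite_eq', Finset.mem_univ, if_true, Pi.zero_apply] at h
  exact (mul_eq_zero.1 h).resolve_right (hg i)

/-- The coordinate at `e i` is `a i * g i`, so `π x = 0` kills every coefficient: adjoining the `y
i` adds nothing new inside the kernel of `π`. -/
lemma mem_of_mem_sup_span_of_map_eq_zero [IsDomain R] (hN : ∀ z ∈ N, π z = 0)
    (he : Function.Injective e)
    (hg : ∀ i, g i ≠ 0) (hy : ∀ i, π (y i) = Pi.single (e i) (g i)) {x : M}
    (hx : x ∈ N ⊔ Submodule.span R (Set.range y)) (h0 : π x = 0) : x ∈ N := by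
  obtain ⟨z, hz, a, rfl⟩ := Submodule.mem_sup_span_range_iff.1 hx
  rw [Finset.sum_eq_zero fun i _ => by
    rw [coeff_eq_zero_of_map_eq_zero hN he hg hy hz h0, zero_smul], add_zero]
  exact hz

lemma finrank_sup_span [IsDomain R] [IsNoetherianRing R] [Module.Finite R M]
    (hN : ∀ z ∈ N, π z = 0) (he : Function.Injective e) (hg : ∀ i, g i ≠ 0)
    (hy : ∀ i, π (y i) = Pi.single (e i) (g i)) :
    Module.finrank R (N ⊔ Submodule.span R (Set.range y) : Submodule R M) =
      Module.finrank R N + Fintype.card ι := by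
  have hlin : LinearIndependent R y := by
    rw [Fintype.linearIndependent_iff]
    intro a ha
    refine coeff_eq_zero_of_map_eq_zero hN he hg hy (zero_mem N) ?_
    rw [ha, add_zero, map_zero]
  have hinf : N ⊓ Submodule.span R (Set.range y) = ⊥ := by
    rw [eq_bot_iff]
    rintro x ⟨hxN, hx⟩
    obtain ⟨a, rfl⟩ := (Submodule.mem_span_range_iff_exists_fun R).1 hx
    have h0 := coeff_eq_zero_of_map_eq_zero hN he hg hy (zero_mem N) (a := a)
      (by rw [zero_add]; exact hN _ hxN)
    rw [Submodule.mem_bot]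
    exact Finset.sum_eq_zero fun i _ => by rw [h0, zero_smul]
  have h := Submodule.rank_sup_add_rank_inf_eq N (Submodule.span R (Set.range y))
  rw [hinf, rank_bot, add_zero, ← Module.finrank_eq_rank, ← Module.finrank_eq_rank,
    ← Module.finrank_eq_rank, finrank_span_eq_card hlin] at h
  exact_mod_cast h

end Coordinates

/-! ### Approximation of `V` by subgroups with prescribed `Φ`. -/

section Approximation

open scoped LaurentPolynomial
open LaurentPolynomial (T)

variable {n p : ℕ}

/-- The shift by `d` as an endomorphism of `Twist n p m`. -/
def twistShift (n p m d : ℕ) : Twist n p m →ₗ[(ZMod p)[T;T⁻¹]] Twist n p m :=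
  let g : Twist n p m →+ Twist n p m :=
    ((toTwist m).symm.trans ((shift n p d).trans (toTwist m))).toAddMonoidHom
  { g with
    map_smul' := LaurentPolynomial.map_smul_of_map_T_smul (RingHom.id _) g (by
      intro b x
      obtain ⟨w, rfl⟩ := (toTwist m).surjective x
      rw [T_smul_toTwist]
      refine Eq.trans ?_ (T_smul_toTwist m b (shift n p d w)).symm
      change toTwist m (shift n p d (shift n p (m * b) w)) = _
      rw [← shift_add, ← shift_add, add_comm]) }

lemma twistShift_toTwist (m d : ℕ) (w : LampBase n p) :
    twistShift n p m d (toTwist m w) = toTwist m (shift n p d w) := rfl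

lemma twistShift_pow (m d l : ℕ) (x : Twist n p m) :
    (twistShift n p m d ^ l) x = twistShift n p m (d * l) x := by
  obtain ⟨w, rfl⟩ := (toTwist m).surjective x
  induction l with
  | zero => rw [pow_zero, twistShift_toTwist, mul_zero, Nat.cast_zero, shift_zero]; rfl
  | succ l ih =>
    rw [pow_succ', Module.End.mul_apply, ih, twistShift_toTwist, twistShift_toTwist,
      twistShift_toTwist, ← shift_add, mul_add_one, Nat.cast_add, add_comm (d : ℤ)]

/-- The subgroup of `A` underlying a submodule of `Twist n p m`. -/
def ofTwist {m : ℕ} (N : Submodule (ZMod p)[T;T⁻¹] (Twist n p m)) : AddSubgroup (LampBase n p) :=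
  N.toAddSubgroup.comap (toTwist m).toAddMonoidHom

lemma mem_ofTwist {m : ℕ} {N : Submodule (ZMod p)[T;T⁻¹] (Twist n p m)} {w : LampBase n p} :
    w ∈ ofTwist N ↔ toTwist m w ∈ N := Iff.rfl

lemma isPeriod_ofTwist {m : ℕ} (N : Submodule (ZMod p)[T;T⁻¹] (Twist n p m)) :
    IsPeriod (ofTwist N) m := by
  rw [isPeriod_iff]
  intro w
  have h : toTwist m (shift n p m w) = (T 1 : (ZMod p)[T;T⁻¹]) • toTwist m w := by
    rw [T_smul_toTwist, mul_one]
  rw [mem_ofTwist, mem_ofTwist, h]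
  refine ⟨fun hw => ?_, N.smul_mem _⟩
  have := N.smul_mem (T (-1)) hw
  rwa [smul_smul, ← LaurentPolynomial.T_add, neg_add_cancel, LaurentPolynomial.T_zero,
    one_smul] at this

lemma twistSpan_ofTwist {m : ℕ} (N : Submodule (ZMod p)[T;T⁻¹] (Twist n p m)) :
    twistSpan m (ofTwist N) = N := by
  refine Submodule.ext fun x => ?_
  obtain ⟨w, rfl⟩ := (toTwist m).surjective x
  rw [toTwist_mem_twistSpan (isPeriod_ofTwist N), mem_ofTwist]

/-- Otherwise `x^d b = c b` modulo the kernel of `π`, which is stable under `x^d`. Iterating `l = m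
/ d` times gives `c^l = T`, so `l = 1`, contrary to `d ≠ m`. -/
lemma exists_twistShift_apply_ne_zero [Fact p.Prime] {κ : Type*} [DecidableEq κ] {m d : ℕ}
    (hd : d ∣ m) (hdm : d ≠ m) (hm : 0 < m)
    {π : Twist n p m →ₗ[(ZMod p)[T;T⁻¹]] (κ → (ZMod p)[T;T⁻¹])}
    (hπ : ∀ x, π x = 0 → π (twistShift n p m d x) = 0) {b : Twist n p m} {k₀ : κ}
    (hb : π b = Pi.single k₀ 1) :
    ∃ k, k ≠ k₀ ∧ π (twistShift n p m d b) k ≠ 0 := by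
  by_contra! h
  obtain ⟨l, rfl⟩ := hd
  set D := twistShift n p (d * l) d
  set c := π (D b) k₀
  have h1 : π (D b) = c • π b := by
    funext k
    rw [hb, Pi.smul_apply]
    by_cases hk : k = k₀
    · subst hk; rw [Pi.single_eq_same, smul_eq_mul, mul_one]
    · rw [Pi.single_eq_of_ne hk, smul_zero, h k hk]
  have h2 : ∀ i, π ((D ^ i) b) = c ^ i • π b := by
    intro i
    induction i with
    | zero => rw [pow_zero, pow_zero, one_smul]; rfl
    | succ i ih =>
      have h3 := hπ ((D ^ i) b - c ^ i • b) (by rw [map_sub, map_smul, ih, sub_self])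
      rw [map_sub, map_sub, map_smul, map_smul, sub_eq_zero] at h3
      rw [pow_succ', Module.End.mul_apply, h3, h1, smul_smul, pow_succ]
  have h4 : c ^ l = T 1 := by
    have h5 := h2 l
    have h6 : (D ^ l) b = (T 1 : (ZMod p)[T;T⁻¹]) • b := by
      obtain ⟨w, rfl⟩ := (toTwist (d * l)).surjective b
      rw [twistShift_pow, twistShift_toTwist, T_smul_toTwist, mul_one]
    rw [h6, map_smul, hb] at h5
    have h7 := congrFun h5 k₀
    simpa using h7.symm
  rw [LaurentPolynomial.eq_one_of_pow_eq_T h4, mul_one] at hdm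
  exact hdm rfl

/-- The subgroups `U` of `A` that have period `m` are limits of subgroups of larger rank and
with least period `m`. -/
lemma exists_approximation [Fact p.Prime] {m : ℕ} (hm : 0 < m) {U : AddSubgroup (LampBase n p)}
    (hU : IsPeriod U m) {j : ℕ} (hj : 0 < j) (hjc : j ≤ corank m U) :
    ∃ U' : ℕ → AddSubgroup (LampBase n p), (∀ i, U ≤ U' i) ∧ (∀ i, IsPeriod (U' i) m) ∧
      (∀ i, corank m (U' i) = corank m U - j) ∧
      (∀ w, ∀ᶠ i in atTop, (w ∈ U' i ↔ w ∈ U)) ∧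
      ∀ d, d ∣ m → d ≠ m → IsPeriod U d → ∀ᶠ i in atTop, ¬ IsPeriod (U' i) d := by
  have : NeZero m := ⟨hm.ne'⟩
  have : NeZero j := ⟨hj.ne'⟩
  set N := twistSpan m U with hN_def
  obtain ⟨π, hsurj, hker⟩ := N.exists_coordinates_modulo_torsion
  have hN : ∀ z ∈ N, π z = 0 := fun z hz => (hker z).2 ⟨1, one_ne_zero, by rwa [one_smul]⟩
  let e : Fin j → Fin (Module.finrank (ZMod p)[T;T⁻¹] (Twist n p m ⧸ N)) := Fin.castLE hjc
  have he : Function.Injective e := Fin.castLE_injective hjc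
  choose b hb using fun i : Fin j => hsurj (Pi.single (e i) 1)
  let h : (ZMod p)[T;T⁻¹] := T 1 - 1
  have hh : h ≠ 0 := LaurentPolynomial.T_sub_one_ne_zero
  -- The vector `b 0` gets the smaller exponent: its image under `x^d` has another nonzero
  -- coordinate, divisible by only about `h^i`, whereas membership in `N' i` demands `h^(2i)` there.
  let g : ℕ → Fin j → (ZMod p)[T;T⁻¹] := fun i k => if k = 0 then h ^ i else h ^ (i + i)
  have hg : ∀ i k, g i k ≠ 0 := by
    intro i k
    simp only [g]
    split_ifs <;> exact pow_ne_zero _ hh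
  have hgd : ∀ i k, h ^ i ∣ g i k := by
    intro i k
    simp only [g]
    split_ifs
    · exact dvd_rfl
    · exact pow_dvd_pow _ (Nat.le_add_left i i)
  have hy : ∀ i k, π (g i k • b k) = Pi.single (e k) (g i k) := by
    intro i k
    rw [map_smul, hb, ← Pi.single_smul, smul_eq_mul, mul_one]
  let N' : ℕ → Submodule (ZMod p)[T;T⁻¹] (Twist n p m) := fun i =>
    N ⊔ Submodule.span _ (Set.range fun k => g i k • b k)
  have hNN' : ∀ i, N ≤ N' i := fun i => le_sup_left
  refine ⟨fun i => ofTwist (N' i), fun i w hw => ?_, fun i => isPeriod_ofTwist _, fun i => ?_,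
    fun w => ?_, fun d hd hdm hUd => ?_⟩
  · exact hNN' i ((toTwist_mem_twistSpan hU).2 hw)
  · have h1 := corank_add_rk m U
    have h2 := corank_add_rk m (ofTwist (N' i))
    have h3 : rk m (ofTwist (N' i)) = rk m U + j := by
      have := finrank_sup_span hN he (hg i) (hy i)
      rw [Fintype.card_fin] at this
      rw [rk, twistSpan_ofTwist]
      exact this
    change corank m (ofTwist (N' i)) = _
    omega
  · by_cases hw : π (toTwist m w) = 0
    · refine Eventually.of_forall fun i => ?_
      rw [mem_ofTwist, ← toTwist_mem_twistSpan hU]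
      exact ⟨fun hx => mem_of_mem_sup_span_of_map_eq_zero hN he (hg i) (hy i) hx hw,
        fun hx => hNN' i hx⟩
    · obtain ⟨k, hk⟩ := Function.ne_iff.1 hw
      filter_upwards [LaurentPolynomial.eventually_not_pow_dvd hk] with i hi
      refine iff_of_false (fun hx => hi ?_) fun hx => hw ?_
      · exact dvd_apply_of_mem_sup_span hN (hy i) hx fun k' _ => hgd i k'
      · exact hN _ ((toTwist_mem_twistSpan hU).2 hx)
  · have hπ : ∀ x, π x = 0 → π (twistShift n p m d x) = 0 := by
      intro x hx
      obtain ⟨a, ha, hax⟩ := (hker x).1 hx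
      refine (hker _).2 ⟨a, ha, ?_⟩
      rw [← map_smul]
      obtain ⟨w, hw⟩ := (toTwist m).surjective (a • x)
      rw [← hw, hN_def, toTwist_mem_twistSpan hU] at hax
      rw [← hw, twistShift_toTwist, hN_def, toTwist_mem_twistSpan hU]
      exact (isPeriod_iff.1 hUd w).2 hax
    obtain ⟨k, hk, hne⟩ := exists_twistShift_apply_ne_zero hd hdm hm hπ (hb 0)
    filter_upwards [LaurentPolynomial.eventually_not_pow_dvd hne] with i hi hper
    -- If `d` were a period, `h^(2i)` would divide `h^i` times a fixed nonzero coordinate;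
    -- cancelling `h^i` contradicts the choice of `i`. A coordinate outside the range of `e`
    -- vanishes on `N' i`, so divisibility holds there too.
    refine hi ((mul_dvd_mul_iff_left (pow_ne_zero i hh)).1 ?_)
    have h1 : g i 0 • b 0 ∈ N' i :=
      Submodule.mem_sup_right (Submodule.subset_span ⟨0, rfl⟩)
    have h2 : twistShift n p m d (g i 0 • b 0) ∈ N' i := by
      obtain ⟨w, hw⟩ := (toTwist m).surjective (g i 0 • b 0)
      rw [← hw] at h1 ⊢
      exact (isPeriod_iff.1 hper w).2 h1
    have h3 := dvd_apply_of_mem_sup_span hN (hy i) h2 (k := k) (h := h ^ (i + i)) (by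
      rintro k' rfl
      have : k' ≠ 0 := fun h0 => hk (by rw [h0])
      simp only [g, if_neg this]
      exact dvd_rfl)
    rw [map_smul, map_smul, Pi.smul_apply, smul_eq_mul, pow_add] at h3
    simpa only [g, if_true] using h3

lemma tendsto_enlarge {V : Subgroup (Lamplighter n p)} {U' : ℕ → AddSubgroup (LampBase n p)}
    (hper : ∀ i, IsPeriod (U' i) (projGen V))
    (h : ∀ w, ∀ᶠ i in atTop, (w ∈ U' i ↔ w ∈ basePart V)) (hle : ∀ i, basePart V ≤ U' i) :
    Tendsto (fun i => enlarge V (U' i) (hper i)) atTop (𝓝 V) := by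
  refine tendsto_subgroup_of_eventually fun g => ?_
  obtain ⟨w, k, rfl⟩ := exists_eq_lampMk g
  by_cases hk : (projGen V : ℤ) ∣ k
  · obtain ⟨v, hv⟩ := (projGen_spec V k).2 hk
    filter_upwards [h (w - v)] with i hi
    rw [← sub_add_cancel w v, lampMk_add_mem_iff hv, lampMk_add_mem_iff (le_enlarge hv),
      basePart_enlarge (hle i), hi]
  · refine Eventually.of_forall fun i => iff_of_false (fun hw => hk ?_) fun hw => hk ?_
    · have := dvd_of_lampMk_mem hw
      rwa [projGen_enlarge] at this
    · exact dvd_of_lampMk_mem hw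

/-- Write `t = t' k`. Then `t' r' < t r` says `r' < k r`, and `k r` is the corank of `U` for `m = e
k`. So the rank of `U` can be raised until the corank is `r'`. With `s` unchanged and least period
`m`, the first coordinate becomes `s / m = t'`. -/
theorem exists_tendsto_of_lt_Phi [Fact p.Prime] (V : ZSet n p) (q : QPoset) (hq : q < Phi V) :
    ∃ W : ℕ → ZSet n p, (∀ m, Phi (W m) = q) ∧ Tendsto W atTop (𝓝 V) := by
  obtain ⟨⟨k, hk⟩, hlt⟩ := hq
  have hepos := (period_pos V.2).1
  have htpos := (Phi V).t.pos
  have hqpos := q.t.pos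
  have hk0 : 0 < k := by
    refine Nat.pos_of_ne_zero ?_
    rintro rfl
    omega
  have : NeZero k := ⟨hk0.ne'⟩
  have : NeZero (period (basePart V.1)) := ⟨hepos.ne'⟩
  set U := basePart V.1
  set m := period U * k
  have hm : 0 < m := Nat.mul_pos hepos hk0
  have hUm : IsPeriod U m := (isPeriod_period V.2).mul k
  have hs : projGen V.1 = m * q.t := by
    rw [← period_mul_Phi_t V, hk]
    ring
  have hc : corank m U = k * (Phi V).r := by
    rw [Phi_r, ← corank_mul (isPeriod_period V.2)]
  have hr : q.r < corank m U := by
    rw [hc]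
    rw [hk, mul_assoc] at hlt
    exact Nat.lt_of_mul_lt_mul_left hlt
  obtain ⟨U', hle, hper, hcor, hconv, hmin⟩ := exists_approximation hm hUm
    (Nat.sub_pos_of_lt hr) (Nat.sub_le _ _)
  have hper' : ∀ i, IsPeriod (U' i) (projGen V.1) := fun i => hs ▸ (hper i).mul q.t
  let W : ℕ → ZSet n p := fun i =>
    ⟨enlarge V.1 (U' i) (hper' i), mem_ZSet_of_le V.2 le_enlarge⟩
  have hW : Tendsto W atTop (𝓝 V) := tendsto_subtype_rng.2 (tendsto_enlarge hper' hconv hle)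
  have hbase : ∀ i, basePart (W i).1 = U' i := fun i => basePart_enlarge (h := hper' i) (hle i)
  have hnot : ∀ d ∈ Finset.range m, ∀ᶠ i in atTop, d ∣ m → ¬ IsPeriod (U' i) d := by
    intro d hd
    have hdm : d ≠ m := (Finset.mem_range.1 hd).ne
    -- Periods `d` of `U` are destroyed by the construction; a `d` that is not a period of `U` stays
    -- a non-period nearby.
    by_cases hdvd : d ∣ m
    · by_cases hUd : IsPeriod U d
      · filter_upwards [hmin d hdvd hdm hUd] with i hi _ using hi
      · have hval : Tendsto (fun i => (W i).1) atTop (𝓝 V.1) :=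
          (continuous_subtype_val.tendsto V).comp hW
        filter_upwards [hval.eventually (eventually_isPeriod_imp V.1 d)] with i hi _ hd'
        refine hUd (hi (le_enlarge (h := hper' i)) ?_)
        rwa [hbase]
    · exact Eventually.of_forall fun _ h => absurd h hdvd
  obtain ⟨i₀, hi₀⟩ := eventually_atTop.1 ((Filter.eventually_all_finset _).2 hnot)
  refine ⟨fun i => W (i + i₀), fun i => ?_, hW.comp (tendsto_add_atTop_nat i₀)⟩
  have hperiod : period (basePart (W (i + i₀)).1) = m := by
    have h1 := period_dvd (period_pos (W (i + i₀)).2).1 (d := m) (by rw [hbase]; exact hper _)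
    by_contra hne
    refine hi₀ (i + i₀) (Nat.le_add_left _ _) _
      (Finset.mem_range.2 (lt_of_le_of_ne (Nat.le_of_dvd hm h1) hne)) h1 ?_
    rw [← hbase (i + i₀)]
    exact isPeriod_period (W (i + i₀)).2
  refine QPoset.ext (PNat.coe_injective ?_) ?_
  · have h1 := period_mul_Phi_t (W (i + i₀))
    have h2 : projGen (W (i + i₀)).1 = projGen V.1 :=
    projGen_enlarge (h := hper' (i + i₀))
    rw [hperiod, h2, hs] at h1
    exact Nat.eq_of_mul_eq_mul_left hm h1
  · rw [Phi_r, hperiod, hbase, hcor]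
    omega

end Approximation

/-! ### The rank of `Q` is `ω`. -/

section Poset

lemma QPoset.lt_iff {a b : QPoset} :
    a < b ↔ (a.t : ℕ) ∣ (b.t : ℕ) ∧ (a.t : ℕ) * a.r < (b.t : ℕ) * b.r := Iff.rfl

lemma QPoset.one_lt_iff {k : ℕ} {b : QPoset} : (⟨1, k⟩ : QPoset) < b ↔ k < (b.t : ℕ) * b.r := by
  rw [QPoset.lt_iff]
  simp

/-- A divisor `t'` of `t` is bounded by `t`, and `r' ≤ t' r' < t r`. -/
lemma QPoset.finite_Iio (b : QPoset) : (Set.Iio b).Finite := by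
  have h : ((Set.Iic (b.t : ℕ)) ×ˢ (Set.Iio ((b.t : ℕ) * b.r))).Finite :=
    (Set.finite_Iic _).prod (Set.finite_Iio _)
  refine Set.Finite.of_injOn (f := fun q : QPoset => ((q.t : ℕ), q.r)) ?_ ?_ h
  · intro q hq
    refine ⟨Nat.le_of_dvd b.t.pos hq.1, lt_of_le_of_lt ?_ hq.2⟩
    exact Nat.le_mul_of_pos_left _ q.t.pos
  · intro q _ q' _ h
    exact QPoset.ext (PNat.coe_injective (congrArg Prod.fst h)) (congrArg Prod.snd h)

/-- Every element with `t r > k` lies above `(1,k)`. -/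
lemma minimalElts_setOf_le (k : ℕ) :
    minimalElts {q : QPoset | k ≤ (q.t : ℕ) * q.r} = {q | (q.t : ℕ) * q.r = k} := by
  ext q
  constructor
  · rintro ⟨h1, h2⟩
    refine le_antisymm ?_ h1
    by_contra! h
    exact h2 ⟨1, k⟩ (by simp) (QPoset.one_lt_iff.2 h)
  · intro h
    refine ⟨(show _ = k from h).ge, fun q' hq' hlt => ?_⟩
    have h1 : (q'.t : ℕ) * q'.r < k := (show _ = k from h) ▸ hlt.2
    exact h1.not_ge hq'

lemma posetLevel_natCast (k : ℕ) :
    posetLevel QPoset (k : Ordinal) = {q | (q.t : ℕ) * q.r ≤ k} := by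
  induction k with
  | zero =>
    rw [posetLevel, Nat.cast_zero, Ordinal.limitRecOn_zero]
    have := minimalElts_setOf_le 0
    simpa using this
  | succ k ih =>
    rw [posetLevel] at ih ⊢
    rw [Nat.cast_succ, Ordinal.limitRecOn_add_one, ih]
    have : {q : QPoset | (q.t : ℕ) * q.r ≤ k}ᶜ = {q | k + 1 ≤ (q.t : ℕ) * q.r} := by
      ext q
      exact not_le (α := ℕ)
    rw [this, minimalElts_setOf_le]
    ext q
    exact Nat.le_succ_iff.symm

lemma posetLevel_omega0 : posetLevel QPoset Ordinal.omega0 = univ := by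
  rw [posetLevel, Ordinal.limitRecOn_limit _ _ _ _ Ordinal.isSuccLimit_omega0]
  refine eq_univ_of_forall fun q => ?_
  refine mem_iUnion₂.2 ⟨((q.t : ℕ) * q.r : ℕ), Ordinal.natCast_lt_omega0 _, ?_⟩
  have h := posetLevel_natCast ((q.t : ℕ) * q.r)
  rw [posetLevel] at h
  rw [h]
  exact le_refl (_ : ℕ)

lemma posetRank_QPoset : posetRank QPoset = Ordinal.omega0 := by
  have hmem : (posetLevel QPoset Ordinal.omega0)ᶜ = (posetLevel QPoset (Ordinal.omega0 + 1))ᶜ := by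
    have : posetLevel QPoset (Ordinal.omega0 + 1) = univ := by
      have h := posetLevel_omega0
      rw [posetLevel] at h ⊢
      rw [Ordinal.limitRecOn_add_one, h, univ_union]
    rw [this, posetLevel_omega0]
  refine le_antisymm (csInf_le' hmem) (le_csInf ⟨_, hmem⟩ fun a ha => ?_)
  by_contra! hlt
  obtain ⟨k, rfl⟩ := Ordinal.lt_omega0.1 hlt
  have h : (⟨1, k + 1⟩ : QPoset) ∈ (posetLevel QPoset (k : Ordinal))ᶜ := by
    rw [posetLevel_natCast]
    simp
  rw [show _ = _ from ha, ← Nat.cast_succ, posetLevel_natCast] at h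
  simp at h

end Poset

/-! ### Subsequences with constant `Φ`, by pigeonhole. -/

section Subsequence

variable {n p : ℕ}

theorem exists_subsequence_of_tendsto [Fact p.Prime] (V : ZSet n p) (W : ℕ → ZSet n p)
    (hW : Tendsto W atTop (𝓝 V)) (hne : ∀ m, W m ≠ V) :
    ∃ φ : ℕ → ℕ, StrictMono φ ∧ ∃ q : QPoset, q < Phi V ∧ ∀ k, Phi (W (φ k)) = q := by
  have h1 : ∀ᶠ m in atTop, Phi (W m) ∈ Set.Iio (Phi V) := by
    filter_upwards [hW.eventually (eventually_le_and_Phi_lt V)] with m hm using hm.2 (hne m)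
  have h2 : ∃ q ∈ Set.Iio (Phi V), ∃ᶠ m in atTop, Phi (W m) = q := by
    by_contra! h
    have h3 : ∀ q ∈ Set.Iio (Phi V), ∀ᶠ m in atTop, Phi (W m) ≠ q :=
      fun q hq => h q hq
    obtain ⟨m, hm, hm'⟩ := (((QPoset.finite_Iio _).eventually_all.2 h3).and h1).exists
    exact hm _ hm' rfl
  obtain ⟨q, hq, hfreq⟩ := h2
  obtain ⟨φ, hφ, hφq⟩ := extraction_of_frequently_atTop hfreq
  exact ⟨φ, hφ, q, hq, hφq⟩

end Subsequence

/-! ### `Sub(A)` has no isolated points. -/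

section Base

variable {n p : ℕ}

/-- A subgroup of `A` as a subgroup of the lamplighter group. -/
def ofBase (U : AddSubgroup (LampBase n p)) : Subgroup (Lamplighter n p) :=
  (AddSubgroup.toSubgroup U).map SemidirectProduct.inl

lemma lampMk_mem_ofBase {U : AddSubgroup (LampBase n p)} {w : LampBase n p} {k : ℤ} :
    lampMk w k ∈ ofBase U ↔ w ∈ U ∧ k = 0 := by
  constructor
  · rintro ⟨u, hu, h⟩
    have h' : lampMk u.toAdd 0 = lampMk w k := h
    obtain ⟨rfl, rfl⟩ := lampMk_inj.1 h'
    exact ⟨hu, rfl⟩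
  · rintro ⟨hw, rfl⟩
    exact ⟨Multiplicative.ofAdd w, hw, rfl⟩

lemma ofBase_le (U : AddSubgroup (LampBase n p)) : ofBase U ≤ baseSubgroup n p := by
  rintro _ ⟨u, -, rfl⟩
  exact ⟨u, rfl⟩

lemma eq_ofBase_of_le {V : Subgroup (Lamplighter n p)} (hV : V ≤ baseSubgroup n p) :
    V = ofBase (basePart V) := by
  ext g
  obtain ⟨w, k, rfl⟩ := exists_eq_lampMk g
  rw [lampMk_mem_ofBase, mem_basePart]
  constructor
  · intro h
    obtain ⟨u, hu⟩ := hV h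
    have hu' : lampMk u.toAdd 0 = lampMk w k := hu
    obtain ⟨rfl, rfl⟩ := lampMk_inj.1 hu'
    exact ⟨h, rfl⟩
  · rintro ⟨h, rfl⟩
    exact h

lemma ofBase_injective : Function.Injective (ofBase (n := n) (p := p)) := by
  intro U U' h
  ext w
  have h1 := lampMk_mem_ofBase (U := U) (w := w) (k := 0)
  rw [h, lampMk_mem_ofBase] at h1
  simpa using h1.symm

/-- If `U` is finite, adjoin a vector outside the span of `U ∪ F`; no new element of `F` is
captured, as a nonzero coefficient could be inverted. If `U` is infinite, replace it by the finite
span of `U ∩ F`. -/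
lemma exists_approximation_in_base [Fact p.Prime] (hn : 1 ≤ n) (U : AddSubgroup (LampBase n p)) :
    ∃ Y : Finset (LampBase n p) → AddSubgroup (LampBase n p), (∀ F, Y F ≠ U) ∧
      ∀ F, ∀ w ∈ F, w ∈ Y F ↔ w ∈ U := by
  classical
  let N : Submodule (ZMod p) (LampBase n p) := AddSubgroup.toZModSubmodule p U
  have hfin : ∀ S : Set (LampBase n p), S.Finite →
      Finite (Submodule.span (ZMod p) S) := by
    intro S hS
    have := Module.Finite.span_of_finite (ZMod p) hS
    exact Module.finite_of_finite (ZMod p)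
  by_cases hU : (U : Set (LampBase n p)).Finite
  · have : Nonempty (Fin n) := ⟨⟨0, hn⟩⟩
    have hinf : ∀ F : Finset (LampBase n p),
        ∃ w, w ∉ Submodule.span (ZMod p) (U ∪ F : Set (LampBase n p)) := by
      intro F
      have := hfin _ (hU.union F.finite_toSet)
      exact (Set.toFinite (Submodule.span (ZMod p) (U ∪ F : Set (LampBase n p)) :
        Set (LampBase n p))).exists_notMem
    choose x hx using hinf
    refine ⟨fun F => (N ⊔ Submodule.span (ZMod p) {x F}).toAddSubgroup, fun F h => ?_,
      fun F w hw => ?_⟩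
    · refine hx F (Submodule.subset_span (Or.inl ?_))
      rw [← h]
      exact Submodule.mem_sup_right (Submodule.mem_span_singleton_self _)
    · refine ⟨fun h => ?_, fun h => Submodule.mem_sup_left (show w ∈ N from h)⟩
      obtain ⟨u, hu, y, hy, rfl⟩ := Submodule.mem_sup.1 h
      obtain ⟨c, rfl⟩ := Submodule.mem_span_singleton.1 hy
      by_cases hc : c = 0
      · rw [hc, zero_smul, add_zero]
        exact hu
      · refine absurd ?_ (hx F)
        have h2 : u ∈ (U ∪ F : Set (LampBase n p)) := Or.inl hu
        have h3 : u + c • x F ∈ (U ∪ F : Set (LampBase n p)) := Or.inr hw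
        have h1 := Submodule.smul_mem _ c⁻¹ (sub_mem (Submodule.subset_span (R := ZMod p) h3)
          (Submodule.subset_span h2))
        rwa [add_sub_cancel_left, smul_smul, inv_mul_cancel₀ hc, one_smul] at h1
  · refine ⟨fun F => (Submodule.span (ZMod p) (U ∩ F : Set (LampBase n p))).toAddSubgroup,
      fun F h => hU ?_, fun F w hw => ⟨fun h => ?_, fun h => Submodule.subset_span ⟨h, hw⟩⟩⟩
    · have := hfin _ (F.finite_toSet.inter_of_right (U : Set (LampBase n p)))
      rw [← h]
      exact Set.toFinite (Submodule.span (ZMod p) (U ∩ F : Set (LampBase n p)) :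
        Set (LampBase n p))
    · have hle : Submodule.span (ZMod p) (U ∩ F : Set (LampBase n p)) ≤ N :=
        Submodule.span_le.2 Set.inter_subset_left
      exact hle h

lemma preperfect_Iic_baseSubgroup [Fact p.Prime] (hn : 1 ≤ n) :
    Preperfect (Set.Iic (baseSubgroup n p)) := by
  intro V hV
  obtain ⟨Y, hne, hY⟩ := exists_approximation_in_base hn (basePart V)
  have hlim : Tendsto (fun F => ofBase (Y F)) atTop (𝓝 V) := by
    refine tendsto_subgroup_of_eventually fun g => ?_
    obtain ⟨w, k, rfl⟩ := exists_eq_lampMk g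
    filter_upwards [eventually_ge_atTop {w}] with F hF
    rw [eq_ofBase_of_le hV, lampMk_mem_ofBase, lampMk_mem_ofBase,
      hY F w (hF (Finset.mem_singleton_self w))]
  rw [accPt_iff_frequently]
  refine hlim.frequently (Eventually.frequently (Eventually.of_forall fun F => ⟨?_, ofBase_le _⟩))
  intro h
  rw [eq_ofBase_of_le hV] at h
  exact hne F (ofBase_injective h)

end Base

/-! ### The Cantor–Bendixson rank of `Sub(L)` is `ω`. -/

section Rank

variable {n p : ℕ}

/-- The cyclic group generated by `(0, k + 1)` meets `A` trivially, so its corank is `n (k + 1) >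
k`. -/
lemma exists_lt_Phi [Fact p.Prime] (hn : 1 ≤ n) (k : ℕ) :
    ∃ V : ZSet n p, k < ((Phi V).t : ℕ) * (Phi V).r := by
  let V : Subgroup (Lamplighter n p) :=
    (Subgroup.zpowers (Multiplicative.ofAdd ((k + 1 : ℕ) : ℤ))).map SemidirectProduct.inr
  have hmem : ∀ w l, lampMk w l ∈ V ↔ w = 0 ∧ ((k + 1 : ℕ) : ℤ) ∣ l := by
    intro w l
    constructor
    · rintro ⟨a, ha, h⟩
      obtain ⟨c, rfl⟩ := Subgroup.mem_zpowers_iff.1 ha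
      have h' : lampMk 0 (c • ((k + 1 : ℕ) : ℤ)) = lampMk w l := h
      obtain ⟨rfl, rfl⟩ := lampMk_inj.1 h'
      exact ⟨rfl, Dvd.intro_left c rfl⟩
    · rintro ⟨rfl, c, rfl⟩
      refine ⟨_, Subgroup.zpow_mem_zpowers _ c, ?_⟩
      change lampMk 0 (c • ((k + 1 : ℕ) : ℤ)) = _
      rw [smul_eq_mul, mul_comm]
  have hs : projGen V = k + 1 := by
    refine Nat.dvd_antisymm (Int.natCast_dvd_natCast.1 (dvd_of_lampMk_mem (w := 0) ?_))
      (Int.natCast_dvd_natCast.1 ?_)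
    · exact (hmem _ _).2 ⟨rfl, dvd_rfl⟩
    · obtain ⟨v, hv⟩ := (projGen_spec V (projGen V)).2 dvd_rfl
      exact ((hmem _ _).1 hv).2
  have hb : basePart V = ⊥ := by
    ext w
    rw [mem_basePart, hmem, AddSubgroup.mem_bot]
    exact and_iff_left (dvd_zero _)
  have hV : V ∈ ZSet n p := by
    intro h
    have h1 := eq_ofBase_of_le h
    have h2 := (hmem 0 ((k + 1 : ℕ) : ℤ)).2 ⟨rfl, dvd_rfl⟩
    rw [h1, lampMk_mem_ofBase] at h2
    have := h2.2
    omega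
  refine ⟨⟨V, hV⟩, ?_⟩
  rw [Phi_t_mul_r]
  change k < corank (projGen V) (basePart V)
  rw [hs, hb]
  have h1 := corank_add_rk (k + 1) (⊥ : AddSubgroup (LampBase n p))
  have h2 : rk (k + 1) (⊥ : AddSubgroup (LampBase n p)) = 0 := by
    have : twistSpan (k + 1) (⊥ : AddSubgroup (LampBase n p)) = ⊥ := by
      rw [twistSpan, AddSubgroup.coe_bot, Set.image_singleton, map_zero,
        Submodule.span_zero_singleton]
    rw [rk, this, finrank_bot]
  have h3 : k + 1 ≤ n * (k + 1) := Nat.le_mul_of_pos_left _ hn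
  omega

/-- The subgroups in `Sub(A)` together with those of the subgroups `V` in `Z` for which
`t_V r_V ≥ k`. -/
def highSubgroups (n p k : ℕ) : Set (Subgroup (Lamplighter n p)) :=
  {V | ∀ h : V ∈ ZSet n p, k ≤ ((Phi ⟨V, h⟩).t : ℕ) * (Phi ⟨V, h⟩).r}

lemma exists_Phi_eq [Fact p.Prime] (hn : 1 ≤ n) (k : ℕ) : ∃ V : ZSet n p, Phi V = ⟨1, k⟩ := by
  obtain ⟨V, hV⟩ := exists_lt_Phi (p := p) hn k
  obtain ⟨W, hW, -⟩ := exists_tendsto_of_lt_Phi V ⟨1, k⟩ (QPoset.one_lt_iff.2 hV)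
  exact ⟨W 0, hW 0⟩

/-- A subgroup in `Z` with `t r = k` is isolated at level `k`, because its neighbours have smaller
`t r`. One with `t r > k` is a limit of subgroups with `Φ = (1,k)`, and points of `Sub(A)` are
limits within `Sub(A)`. -/
lemma relDerivedSet_highSubgroups [Fact p.Prime] (hn : 1 ≤ n) (k : ℕ) :
    relDerivedSet (highSubgroups n p k) = highSubgroups n p (k + 1) := by
  have hsub : Set.Iic (baseSubgroup n p) ⊆ highSubgroups n p k := fun V hV h => absurd hV h
  rw [relDerivedSet_apply]
  ext V
  by_cases hV : V ∈ ZSet n p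
  · constructor
    · rintro ⟨hacc, hk⟩ h
      refine lt_of_le_of_ne (hk hV) fun heq => ?_
      have hev := eventually_le_and_Phi_lt ⟨V, hV⟩
      rw [nhds_subtype, eventually_comap] at hev
      obtain ⟨W, ⟨hne, hWk⟩, hle, hW⟩ := ((accPt_iff_frequently.1 hacc).and_eventually
        ((eventually_le_of_mem_ZSet hV).and hev)).exists
      have hWZ := mem_ZSet_of_le hV hle
      have hlt := ((hW ⟨W, hWZ⟩ rfl).2 fun h => hne (congrArg Subtype.val h)).2
      exact (hWk hWZ).not_gt (heq ▸ hlt)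
    · intro h
      have hk := h hV
      refine ⟨?_, fun h' => (Nat.le_succ k).trans (h h')⟩
      obtain ⟨W, hW, hlim⟩ := exists_tendsto_of_lt_Phi ⟨V, hV⟩ ⟨1, k⟩ (QPoset.one_lt_iff.2 hk)
      rw [mem_derivedSet, accPt_iff_frequently]
      have hlim' : Tendsto (fun i => (W i).1) atTop (𝓝 V) :=
        (continuous_subtype_val.tendsto _).comp hlim
      refine hlim'.frequently (Eventually.frequently (Eventually.of_forall fun i => ⟨?_, ?_⟩))
      · intro heq
        have h1 : W i = ⟨V, hV⟩ := Subtype.ext heq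
        have h2 := hW i
        rw [h1] at h2
        rw [h2] at hk
        simp at hk
      · intro h'
        have h2 : Phi ⟨(W i).1, h'⟩ = ⟨1, k⟩ := hW i
        rw [h2]
        simp
  · have hV' : V ≤ baseSubgroup n p := not_not.1 hV
    refine iff_of_true ⟨?_, hsub hV'⟩ fun h => absurd h hV
    exact (preperfect_Iic_baseSubgroup hn V hV').mono (principal_mono.2 hsub)

lemma iteratedDerivedSet_natCast [Fact p.Prime] (hn : 1 ≤ n) (k : ℕ) :
    CantorBendixson.iteratedDerivedSet (univ : Set (Subgroup (Lamplighter n p))) (k : Ordinal) =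
      highSubgroups n p k := by
  induction k with
  | zero =>
    rw [Nat.cast_zero, CantorBendixson.iteratedDerivedSet_zero]
    exact (eq_univ_of_forall fun V _ => Nat.zero_le _).symm
  | succ k ih =>
    rw [Nat.cast_succ, CantorBendixson.iteratedDerivedSet_succ, ih,
      relDerivedSet_highSubgroups hn]

/-- Each `V` in `Z` is gone at stage `t_V r_V + 1`, while `Sub(A)`, having no isolated points,
survives every stage. -/
lemma iteratedDerivedSet_of_omega0_le [Fact p.Prime] (hn : 1 ≤ n) {b : Ordinal}
    (hb : Ordinal.omega0 ≤ b) :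
    CantorBendixson.iteratedDerivedSet (univ : Set (Subgroup (Lamplighter n p))) b =
      Set.Iic (baseSubgroup n p) := by
  refine subset_antisymm ?_ ?_
  · refine (CantorBendixson.iteratedDerivedSet_antitone _ hb).trans ?_
    rw [CantorBendixson.iteratedDerivedSet_limit Ordinal.isSuccLimit_omega0]
    intro V hV
    by_contra hVA
    have h := mem_iInter.1 hV ⟨(((Phi ⟨V, hVA⟩).t : ℕ) * (Phi ⟨V, hVA⟩).r + 1 : ℕ),
      Ordinal.natCast_lt_omega0 _⟩
    rw [iteratedDerivedSet_natCast hn] at h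
    exact (h hVA).not_gt (Nat.lt_succ_self _)
  · have h1 := CantorBendixson.iteratedDerivedSet_mono
      (Set.subset_univ (Set.Iic (baseSubgroup n p))) b
    have h2 := CantorBendixson.iteratedDerivedSet_constant_iff_preperfect.1
      (preperfect_Iic_baseSubgroup (p := p) hn) b
    simp only [h2] at h1
    exact h1

theorem cbRank_subgroup_lamplighter [Fact p.Prime] (hn : 1 ≤ n) :
    cbRank (Subgroup (Lamplighter n p)) = Ordinal.omega0 := by
  have hmem : ∀ b, Ordinal.omega0 ≤ b →
      CantorBendixson.iteratedDerivedSet (univ : Set (Subgroup (Lamplighter n p))) b =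
      CantorBendixson.iteratedDerivedSet (univ : Set (Subgroup (Lamplighter n p)))
        Ordinal.omega0 := fun b hb => by
    rw [iteratedDerivedSet_of_omega0_le hn hb, iteratedDerivedSet_of_omega0_le hn le_rfl]
  refine le_antisymm (csInf_le' hmem) (le_csInf ⟨_, hmem⟩ fun a ha => ?_)
  by_contra! hlt
  obtain ⟨k, rfl⟩ := Ordinal.lt_omega0.1 hlt
  have h := ha ((k + 1 : ℕ) : Ordinal) (by exact_mod_cast Nat.le_succ k)
  rw [iteratedDerivedSet_natCast hn, iteratedDerivedSet_natCast hn] at h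
  -- No finite stage is stable: a subgroup with `Φ = (1,k)` is in the `k`-th derivative but not in
  -- the next one.
  obtain ⟨V, hV⟩ := exists_Phi_eq (p := p) hn k
  have h1 : V.1 ∈ highSubgroups n p k := by
    intro _
    rw [show (⟨V.1, _⟩ : ZSet n p) = V from rfl, hV]
    simp
  rw [← h] at h1
  have h2 := h1 V.2
  rw [show (⟨V.1, _⟩ : ZSet n p) = V from rfl, hV] at h2
  simp at h2

end Rank

end

theorem mainTheorem2 (n p : ℕ) [Fact p.Prime] (hn : 1 ≤ n) :
    (∀ V : ZSet n p, ∀ᶠ W in 𝓝 V, V.1 ≤ W.1 ∧ (W ≠ V → Phi W < Phi V)) ∧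
    (∀ (V : ZSet n p) (q : QPoset), q < Phi V →
      ∃ W : ℕ → ZSet n p, (∀ m, Phi (W m) = q) ∧ Tendsto W atTop (𝓝 V)) ∧
    (∀ (V : ZSet n p) (W : ℕ → ZSet n p), Tendsto W atTop (𝓝 V) → (∀ m, W m ≠ V) →
      ∃ φ : ℕ → ℕ, StrictMono φ ∧ ∃ q : QPoset, q < Phi V ∧ ∀ k, Phi (W (φ k)) = q) ∧
    cbRank (Subgroup (Lamplighter n p)) = posetRank QPoset :=
  ⟨eventually_le_and_Phi_lt, exists_tendsto_of_lt_Phi, exists_subsequence_of_tendsto, by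
    rw [cbRank_subgroup_lamplighter hn, posetRank_QPoset]⟩
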